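/- Let $(\mathbb B,\|\cdot\|)$ be a separable real Banach space, let $P$ be a Borel probability distribution on $\mathbb B$ with Bochner mean $\theta=\mathbb E_{W\sim P}[W]$ (so $\mathbb E_P\|W\|<\infty$), and let $\Theta\subseteq\mathbb B$ be open with $\theta\in\Theta$. Put $$\nu=\sup_{\|u\|_*\le 1}\mathbb E_P|\langle W-\theta,u\rangle|^2,\qquad V=\mathbb E_P\|W-\theta\|^2 .$$ Let $m=s+\rho$ with an integer $s=\lceil m\rceil-1\ge 0$ and $\rho\in(0,1]$, and let $f:\Theta\to\mathbb R$ be $s$ times continuously Fréchet differentiable. Write $\mathcal D^kf$ for its $k$-th Fréchet derivative ($\mathcal D^0f=f$), $\|T\|_{\mathrm S}=\sup\{|T[h_1,\dots,h_k]|:\|h_1\|=\dots=\|h_k\|=1\}$ for a bounded $k$-linear form $T$, and $$L=\|\mathcal D^sf\|_{\mathrm{Lip}_\rho(\Theta)}=\sup_{x\ne y\in\Theta}\frac{\|\mathcal D^sf(x)-\mathcal D^sf(y)\|_{\mathrm S}}{\|x-y\|^\rho}.$$ Let $n\ge\max(1,s)$, $N=2n$, let $W_1,\dots,W_{2n}$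 be i.i.d. with law $P$, and put $\mathcal S_1=(W_1,\dots,W_n)$, $\mathcal S_2=(W_{n+1},\dots,W_{2n})$. Let $\hat\theta_{\mathcal S_1}$, $\hat\theta_{\mathcal S_2}$ be measurable functions of $\mathcal S_1$ and of $\mathcal S_2$, respectively, with the same distribution as a random element $\hat\theta_n$ of $\mathbb B$. Assume that $\hat\theta_n\in\Theta$ almost surely and, if $s\ge1$, that the segment $[\theta,\hat\theta_n]$ is contained in $\Theta$ almost surely (automatic if $\Theta$ is convex). For a sample $\mathcal S=(w_1,\dots,w_n)$ and $b\in\mathbb B$ write $$T[\bar U^{(k)}_{\mathcal S}(b)]=\binom nk^{-1}\sum_{1\le j_1<\dots<j_k\le n}T[w_{j_1}-b,\dots,w_{j_k}-b],$$ and define the cross-fitted estimator by $$\widehat f_s(\mathcal S,\mathcal S')=f(\hat\theta_{\mathcal S'})+\sum_{k=1}^s\frac1{k!}\mathcal D^kf(\hat\theta_{\mathcal S'})\big[\bar U^{(k)}_{\mathcal S}(\hat\theta_{\mathcal S'})\big],\qquad \widehat f_s=\tfrac12\big(\widehat f_s(\mathcal S_1,\mathcal S_2)+\widehat f_s(\mathcal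 S_2,\mathcal S_1)\big).$$ Then, with both sides understood in $[0,\infty]$, $0\cdot\infty=0$, $0^0=\infty^0=1$, and $\mathbb E^{1/2}[X]=(\mathbb E X)^{1/2}$, $$\begin{aligned}\mathbb E^{1/2}\big[|\widehat f_s-f(\theta)|^2\big]\le{}&\sqrt2\,L\,\mathbb E^{1/2}\|\hat\theta_n-\theta\|^{2m}+\sqrt{\frac{2\nu}n}\sum_{k=1}^s\|\mathcal D^kf(\theta)\|_{\mathrm S}\Big(\sqrt{\frac Vn}\Big)^{k-1}\\&+\sqrt{\frac{2e\nu}n}\,L\,\mathbb E^{1/2}\Big[\Big(\|\hat\theta_n-\theta\|^2\vee\frac Vn\Big)^{m-1}\Big]\mathbf 1(s\ge1).\end{aligned}$$ Moreover, if $s\ge1$, then with $\bar W_N=N^{-1}\sum_{i=1}^NW_i$, $$\begin{aligned}\mathbb E^{1/2}\Big[N\big(\widehat f_s-f(\theta)-\mathcal D^1f(\theta)[\bar W_N-\theta]\big)^2\Big]\le{}&\sqrt{4n}\,L\,\mathbb E^{1/2}\|\hat\theta_n-\theta\|^{2m}+\sqrt{4\nu}\sum_{k=2}^s\|\mathcal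 D^kf(\theta)\|_{\mathrm S}\Big(\sqrt{\frac Vn}\Big)^{k-1}\\&+\sqrt{4e\nu}\,L\,\mathbb E^{1/2}\Big[\Big(\|\hat\theta_n-\theta\|^2\vee\frac Vn\Big)^{m-1}\Big].\end{aligned}$$ -/

import Mathlib

open MeasureTheory ProbabilityTheory
open scoped ENNReal Nat

noncomputable section

namespace CrossFit

variable {B : Type*} [NormedAddCommGroup B] [NormedSpace ℝ B]

/-- `E^{1/2}[X]` for a `[0,∞]`-valued random variable `X`. -/
def rootMean {Ω : Type*} [MeasurableSpace Ω] (μ : Measure Ω) (X : Ω → ℝ≥0∞) : ℝ≥0∞ :=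
  (∫⁻ ω, X ω ∂μ) ^ (1 / 2 : ℝ)

/-- Square root on `[0,∞]`. -/
def sqrtE (a : ℝ≥0∞) : ℝ≥0∞ := a ^ (1 / 2 : ℝ)

/-- The mean `θ(P) = E_{W ∼ P}[W]`, a Bochner integral. -/
def mean [MeasurableSpace B] (P : Measure B) : B := ∫ w, w ∂P

/-- Weak variance `ν(P) = sup_{‖u‖_* ≤ 1} E |⟨W - θ, u⟩|²`. -/
def weakVar [MeasurableSpace B] (P : Measure B) : ℝ≥0∞ :=
  ⨆ (u : StrongDual ℝ B) (_ : ‖u‖ ≤ 1), ∫⁻ w, ‖u (w - mean P)‖ₑ ^ 2 ∂P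

/-- Strong variance `V(P) = E ‖W - θ‖²`. -/
def strongVar [MeasurableSpace B] (P : Measure B) : ℝ≥0∞ :=
  ∫⁻ w, ‖w - mean P‖ₑ ^ 2 ∂P

/-- The Hölder seminorm `sup_{x, y ∈ U} ‖g x - g y‖ / ‖x - y‖ ^ ρ`, with values in `[0,∞]`.
For `ρ > 0` the diagonal contributes `0 / 0 = 0`. -/
def lipSeminorm {E : Type*} [NormedAddCommGroup E] (ρ : ℝ) (U : Set B) (g : B → E) : ℝ≥0∞ :=
  ⨆ (x ∈ U) (y ∈ U), ‖g x - g y‖ₑ / ‖x - y‖ₑ ^ ρ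

open Classical in
/-- `T[Ū^{(k)}(b)]`: the average of `T[w_{j₁} - b, …, w_{j_k} - b]` over all
`j₁ < ⋯ < j_k` among the `n` sample points. -/
def uStat {n k : ℕ} (w : Fin n → B) (b : B)
    (T : ContinuousMultilinearMap ℝ (fun _ : Fin k => B) ℝ) : ℝ :=
  ((n.choose k : ℕ) : ℝ)⁻¹ *
    ∑ J : Fin k → Fin n with StrictMono J, T (fun i => w (J i) - b)

/-- One-sided estimator: U-statistics computed from the sample `w`, expanded around the
pilot value `t`. -/
def oneSided {n : ℕ} (f : B → ℝ) (s : ℕ) (w : Fin n → B) (t : B) : ℝ :=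
  f t + ∑ k ∈ Finset.Icc 1 s, ((k ! : ℕ) : ℝ)⁻¹ * uStat w t (iteratedFDeriv ℝ k f t)

/-- The first half `w₁, …, w_n` of a sample of size `2n`. -/
def half₁ {n : ℕ} (w : Fin (n + n) → B) : Fin n → B := fun i => w (Fin.castAdd n i)

/-- The second half `w_{n+1}, …, w_{2n}` of a sample of size `2n`. -/
def half₂ {n : ℕ} (w : Fin (n + n) → B) : Fin n → B := fun i => w (Fin.natAdd n i)

/-- The cross-fitted estimator `f̂_s`: `T₁` is the pilot estimator applied to the first half,
`T₂` the one applied to the second half. -/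
def crossFit {n : ℕ} (f : B → ℝ) (s : ℕ) (T₁ T₂ : (Fin n → B) → B)
    (w : Fin (n + n) → B) : ℝ :=
  (1 / 2) * (oneSided f s (half₁ w) (T₂ (half₂ w)) + oneSided f s (half₂ w) (T₁ (half₁ w)))

/-- The full sample average `W̄_N`, `N = 2n`. -/
def sampleMean {N : ℕ} (w : Fin N → B) : B := (N : ℝ)⁻¹ • ∑ i, w i

end CrossFit

end

/-! Fix a pilot value t, independent of the sample that enters the U-statistics. Write w_i - t =
(w_i - θ) + (θ - t), expand multilinearly, which uses the symmetry of the derivatives, and group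
terms by the set R of indices whose centred points w_i - θ occur. The weights 1/(k! C(n,k)) are
exactly such that R receives 1/(|R|! C(n,|R|)) times the Taylor polynomial at t, evaluated at θ, of
x ↦ D^{|R|}f(x)[w_i - θ, i ∈ R]. Subtracting f(θ) and the U-statistics of the D^k f(θ) leaves only
Taylor remainders (`oneSided_sub_eq_sum_taylorRem`), each at most L‖t - θ‖^{m-|R|} ∏_{i∈R} ‖w_i - θ‖
/ (s - |R|)! (`enorm_taylorRem_le`).

The remainders are linear in every centred point, so those of different R are orthogonal
(`lintegral_sq_sum_le`). In the second moment of one of them, one point meets only a continuous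
functional and costs ν, while the other |R| - 1 points cost V each (`lintegral_sq_le_of_bound`).
Summation over the sets of size k ≥ 1 yields (ν/n)(V/n)^{k-1}, the empty set yields the bias term,
and the sum of the 1/(s - k)! yields e. Integrating over the law of the pilot gives the remainder
bound; the U-statistics at θ obey the same variance estimate (`lintegral_uStat_sq_le`).

Minkowski's inequality combines the pieces and averages the two halves without loss, so the bound
holds with smaller constants than those stated. For the linearised error, the degree-one terms of
the two halves average exactly to Df(θ)[W̄_N - θ], hence only degrees k ≥ 2 remain. -/

noncomputable section

namespace CrossFit

/-! ### Iterated derivatives along multisets of vectors, and their symmetry. -/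

section Derivatives

variable {B : Type*} [NormedAddCommGroup B] [NormedSpace ℝ B] {f : B → ℝ} {s : ℕ} {x : B}

/-- The iterated derivative of `f` at `x` along the vectors of a list. -/
def listDeriv (f : B → ℝ) (x : B) (l : List B) : ℝ := iteratedFDeriv ℝ l.length f x l.get

/-- The iterated derivative of `f` at `x` along the vectors of a multiset. -/
def multiDeriv (f : B → ℝ) (x : B) (M : Multiset B) : ℝ := listDeriv f x M.toList

theorem iteratedFDeriv_apply_eq_listDeriv (f : B → ℝ) (x : B) {k : ℕ} (v : Fin k → B) :
    iteratedFDeriv ℝ k f x v = listDeriv f x (List.ofFn v) := by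
  -- The order is a free variable here, so that the length equation can be eliminated by
  -- substitution.
  have key : ∀ (l : List B) (j : ℕ) (h : l.length = j),
      iteratedFDeriv ℝ j f x (fun i => l.get (i.cast h.symm)) = listDeriv f x l := by
    rintro l _ rfl
    rfl
  rw [← key (List.ofFn v) k (by simp)]
  congr 1
  ext i
  simp

theorem hasFDerivAt_listDeriv (hf : ContDiffAt ℝ s f x) {l : List B} (hl : l.length < s) :
    HasFDerivAt (fun y => listDeriv f y l)
      ((ContinuousMultilinearMap.apply ℝ (fun _ : Fin l.length => B) ℝ l.get).comp
        (fderiv ℝ (iteratedFDeriv ℝ l.length f) x)) x := by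
  have h : ContDiffAt ℝ 1 (iteratedFDeriv ℝ l.length f) x :=
    hf.iteratedFDeriv_right (by norm_cast; omega)
  exact (ContinuousMultilinearMap.apply ℝ (fun _ : Fin l.length => B) ℝ l.get).hasFDerivAt.comp x
    (h.differentiableAt (by simp)).hasFDerivAt

theorem listDeriv_cons (hf : ContDiffAt ℝ s f x) (a : B) {l : List B} (hl : l.length < s) :
    listDeriv f x (a :: l) = fderiv ℝ (fun y => listDeriv f y l) x a := by
  rw [(hasFDerivAt_listDeriv hf hl).fderiv]
  change iteratedFDeriv ℝ (l.length + 1) f x (a :: l).get = _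
  rw [iteratedFDeriv_succ_apply_left]
  rfl

theorem contDiffAt_listDeriv (hf : ContDiffAt ℝ s f x) {l : List B} {j : ℕ}
    (hl : j + l.length ≤ s) : ContDiffAt ℝ j (fun y => listDeriv f y l) x :=
  (ContinuousMultilinearMap.apply ℝ (fun _ : Fin l.length => B) ℝ l.get).contDiff.contDiffAt.comp x
    (hf.iteratedFDeriv_right (by exact_mod_cast hl))

theorem eventually_contDiffAt (hf : ContDiffAt ℝ s f x) : ∀ᶠ y in nhds x, ContDiffAt ℝ s f y :=
  hf.eventually (by simp)

/-- Symmetry of the iterated derivatives. -/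
theorem listDeriv_perm {l l' : List B} (h : l.Perm l') :
    ∀ {x : B}, ContDiffAt ℝ s f x → l.length ≤ s → listDeriv f x l = listDeriv f x l' := by
  induction h with
  | nil => intros; rfl
  | @cons a l l' h ih =>
    intro x hf hl
    have hl' : l.length < s := by simpa using hl
    rw [listDeriv_cons hf a hl', listDeriv_cons hf a (h.length_eq ▸ hl')]
    -- The equality is about to be differentiated, so it is needed near x and not only at x; this is
    -- why the induction keeps the base point quantified.
    have : (fun y => listDeriv f y l) =ᶠ[nhds x] fun y => listDeriv f y l' :=
      (eventually_contDiffAt hf).mono fun y hy => ih hy hl'.le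
    rw [this.fderiv_eq]
  | swap a b l =>
    intro x hf hl
    have hl2 : 2 + l.length ≤ s := by simp at hl; omega
    have hg : ContDiffAt ℝ 2 (fun y => listDeriv f y l) x := contDiffAt_listDeriv hf hl2
    -- The first two slots are the second derivative of the function y ↦ `listDeriv f y l`, whose
    -- symmetry is classical.
    have hd : ∀ (c d : B), listDeriv f x (c :: d :: l) =
        fderiv ℝ (fderiv ℝ fun y => listDeriv f y l) x c d := by
      intro c d
      rw [listDeriv_cons hf c (by simp; omega)]
      have : (fun y => listDeriv f y (d :: l)) =ᶠ[nhds x]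
          fun y => fderiv ℝ (fun z => listDeriv f z l) y d :=
        (eventually_contDiffAt hf).mono fun y hy => listDeriv_cons hy d (by omega)
      rw [this.fderiv_eq]
      have h1 : DifferentiableAt ℝ (fderiv ℝ fun y => listDeriv f y l) x :=
        (hg.fderiv_right (m := 1) (by norm_num)).differentiableAt (by simp)
      have := (((ContinuousLinearMap.apply ℝ ℝ d).hasFDerivAt).comp x h1.hasFDerivAt).fderiv
      exact congrArg (fun u => u c) this
    rw [hd, hd]
    exact hg.isSymmSndFDerivAt (by simp) _ _
  | trans h₁ h₂ ih₁ ih₂ =>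
    intro x hf hl
    rw [ih₁ hf hl, ih₂ hf (h₁.length_eq ▸ hl)]

theorem multiDeriv_coe (hf : ContDiffAt ℝ s f x) {l : List B} (hl : l.length ≤ s) :
    multiDeriv f x l = listDeriv f x l :=
  listDeriv_perm (Multiset.coe_eq_coe.1 (Multiset.coe_toList _)) hf (by simpa using hl)

theorem multiDeriv_univ_map (hf : ContDiffAt ℝ s f x) {k : ℕ} (hk : k ≤ s) (v : Fin k → B) :
    multiDeriv f x (Finset.univ.val.map v) = iteratedFDeriv ℝ k f x v := by
  rw [Fin.univ_val_map, multiDeriv_coe hf (by simpa using hk), iteratedFDeriv_apply_eq_listDeriv]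

@[simp]
theorem multiDeriv_zero (f : B → ℝ) (x : B) : multiDeriv f x 0 = f x := by
  rw [multiDeriv, Multiset.toList_zero]
  simp [listDeriv]

/-- By symmetry the new vector may be taken as the last direction of differentiation, where the
dependence is that of a Fréchet derivative. This provides the linearity in a single sample point
used for centring and for ν. -/
theorem exists_dual_multiDeriv_cons (hf : ContDiffAt ℝ s f x) {M : Multiset B} (hM : M.card < s) :
    ∃ u : StrongDual ℝ B, ∀ y, multiDeriv f x (y ::ₘ M) = u y := by
  refine ⟨fderiv ℝ (fun z => listDeriv f z M.toList) x, fun y => ?_⟩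
  rw [← listDeriv_cons hf y (by simpa using hM), ← multiDeriv_coe hf (by simpa using hM)]
  rw [← Multiset.cons_coe, Multiset.coe_toList]

theorem hasDerivAt_multiDeriv_line {t h : B} {τ : ℝ} (hf : ContDiffAt ℝ s f (t + τ • h))
    {M : Multiset B} (hM : M.card < s) :
    HasDerivAt (fun r : ℝ => multiDeriv f (t + r • h) M) (multiDeriv f (t + τ • h) (h ::ₘ M)) τ := by
  have h1 := hasFDerivAt_listDeriv (l := M.toList) hf (by simpa using hM)
  have h2 : HasDerivAt (fun r : ℝ => t + r • h) h τ := by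
    simpa using ((hasDerivAt_id τ).smul_const h).const_add t
  have h3 := h1.comp_hasDerivAt τ h2
  have h4 : multiDeriv f (t + τ • h) (h ::ₘ M) =
      fderiv ℝ (fun z => listDeriv f z M.toList) (t + τ • h) h := by
    rw [← listDeriv_cons hf h (by simpa using hM), ← multiDeriv_coe hf (by simpa using hM)]
    rw [← Multiset.cons_coe, Multiset.coe_toList]
  rw [h4, h1.fderiv]
  exact h3

theorem enorm_multilinear_apply_le {k : ℕ}
    (T : ContinuousMultilinearMap ℝ (fun _ : Fin k => B) ℝ) (v : Fin k → B) :
    ‖T v‖ₑ ≤ ‖T‖ₑ * ∏ i, ‖v i‖ₑ := by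
  have := T.le_opNorm v
  have h2 := ENNReal.ofReal_le_ofReal this
  rwa [ENNReal.ofReal_mul (norm_nonneg _), ENNReal.ofReal_prod_of_nonneg (by simp),
    ofReal_norm, ofReal_norm, Finset.prod_congr rfl fun i _ => ofReal_norm (v i)] at h2

theorem prod_enorm_get {E : Type*} [NormedAddCommGroup E] (l : List E) : ∏ i, ‖l.get i‖ₑ = (l.map (fun y => ‖y‖ₑ)).prod := by
  rw [← List.prod_ofFn]
  congr 1
  exact List.ofFn_getElem_eq_map l _

theorem enorm_multiDeriv_le (f : B → ℝ) (x : B) {M : Multiset B} {k : ℕ} (hM : M.card = k) :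
    ‖multiDeriv f x M‖ₑ ≤ ‖iteratedFDeriv ℝ k f x‖ₑ * (M.map fun y => ‖y‖ₑ).prod := by
  subst hM
  rw [← Multiset.length_toList]
  refine (enorm_multilinear_apply_le _ _).trans_eq ?_
  rw [prod_enorm_get, ← Multiset.prod_coe, ← Multiset.map_coe, Multiset.coe_toList]

theorem enorm_multiDeriv_sub_le (f : B → ℝ) (x y : B) {M : Multiset B} {k : ℕ} (hM : M.card = k) :
    ‖multiDeriv f x M - multiDeriv f y M‖ₑ ≤
      ‖iteratedFDeriv ℝ k f x - iteratedFDeriv ℝ k f y‖ₑ * (M.map fun y => ‖y‖ₑ).prod := by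
  subst hM
  rw [← Multiset.length_toList]
  have : multiDeriv f x M - multiDeriv f y M = (iteratedFDeriv ℝ M.toList.length f x -
    iteratedFDeriv ℝ M.toList.length f y) M.toList.get := rfl
  rw [this]
  refine (enorm_multilinear_apply_le _ _).trans_eq ?_
  rw [prod_enorm_get, ← Multiset.prod_coe, ← Multiset.map_coe, Multiset.coe_toList]

/-- Multilinear expansion of the derivative along sums `a i + b`. -/
theorem multiDeriv_map_add {ι : Type*} [DecidableEq ι] (hf : ContDiffAt ℝ s f x) (a : ι → B)
    (b : B) (A : Finset ι) (N : Multiset B) (hA : A.card + N.card ≤ s) :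
    multiDeriv f x (A.val.map (fun i => a i + b) + N) =
      ∑ R ∈ A.powerset,
        multiDeriv f x (R.val.map a + Multiset.replicate (A.card - R.card) b + N) := by
  -- `N` collects the vectors already peeled off: after splitting a i + b by linearity, either
  -- summand is moved into `N`, giving the subsets with and without i.
  induction A using Finset.induction_on generalizing N with
  | empty => simp
  | @insert i A hi ih =>
    rw [Finset.card_insert_of_notMem hi] at hA
    rw [Finset.sum_powerset_insert hi, Finset.insert_val_of_notMem hi, Multiset.map_cons,
      Multiset.cons_add, ← Multiset.add_cons]
    obtain ⟨u, hu⟩ := exists_dual_multiDeriv_cons hf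
      (M := A.val.map (fun i => a i + b) + N) (by simp; omega)
    rw [Multiset.add_cons, hu, map_add, ← hu, ← hu, ← Multiset.add_cons, ← Multiset.add_cons,
      ih _ (by simp; omega), ih _ (by simp; omega), add_comm]
    congr 1
    · refine Finset.sum_congr rfl fun R hR => ?_
      have hRA := Finset.card_le_card (Finset.mem_powerset.1 hR)
      rw [Finset.card_insert_of_notMem hi, Nat.sub_add_comm hRA, Multiset.replicate_succ]
      simp
    · refine Finset.sum_congr rfl fun R hR => ?_
      have hiR : i ∉ R := fun h => hi (Finset.mem_powerset.1 hR h)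
      rw [Finset.card_insert_of_notMem hi, Finset.card_insert_of_notMem hiR,
        Finset.insert_val_of_notMem hiR, Nat.add_sub_add_right]
      simp

/-- Enumerating R increasingly fixes one ordering for all z, so the expression is a single
continuous multilinear map composed with continuous arguments. Measurability in the sample comes
from here. -/
theorem continuous_multiDeriv_map {ι : Type*} [LinearOrder ι] (hf : ContDiffAt ℝ s f x)
    {X : Type*} [TopologicalSpace X] {a : X → ι → B} (ha : ∀ i, Continuous fun z => a z i)
    (R : Finset ι) (N : Multiset B) (hR : R.card + N.card ≤ s) :
    Continuous fun z => multiDeriv f x (R.val.map (a z) + N) := by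
  have h1 : ∀ z, R.val.map (a z) + N = ((Finset.univ.val.map
      (Fin.append (fun i => a z (R.orderEmbOfFin rfl i)) N.toList.get) : Multiset B)) := by
    intro z
    rw [Fin.univ_val_map, List.ofFn_fin_append, ← Multiset.coe_add, List.ofFn_get,
      Multiset.coe_toList, ← Fin.univ_val_map]
    congr 1
    conv_lhs => rw [← Finset.image_orderEmbOfFin_univ R rfl,
      Finset.image_val_of_injOn (RelEmbedding.injective _).injOn, Multiset.map_map]
    rfl
  simp_rw [h1]
  have h2 : R.card + N.toList.length ≤ s := by simpa using hR
  simp_rw [fun z => multiDeriv_univ_map hf h2 (Fin.append (fun i => a z (R.orderEmbOfFin rfl i))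
    N.toList.get)]
  refine (ContinuousMultilinearMap.cont _).comp (continuous_pi fun i => ?_)
  induction i using Fin.addCases with
  | left i => simpa using ha _
  | right i => simpa using continuous_const

end Derivatives

/-! ### Taylor remainders under a Hölder condition. -/

/-- Taylor's formula with remainder controlled by the oscillation of the last derivative. -/
theorem taylor_bound_of_hasDerivAt {C : ℝ} (r : ℕ) : ∀ (g : ℕ → ℝ → ℝ),
    (∀ i < r, ∀ τ ∈ Set.Icc (0 : ℝ) 1, HasDerivAt (g i) (g (i + 1) τ) τ) →
    (∀ τ ∈ Set.Icc (0 : ℝ) 1, |g r τ - g r 0| ≤ C) →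
    ∀ τ ∈ Set.Icc (0 : ℝ) 1,
      |g 0 τ - ∑ i ∈ Finset.range (r + 1), (i ! : ℝ)⁻¹ * g i 0 * τ ^ i| ≤ (r ! : ℝ)⁻¹ * C * τ ^ r := by
  induction r with
  | zero =>
    intro g _ hC τ hτ
    simpa using hC τ hτ
  | succ r ih =>
    intro g hg hC
    have ih' := ih (fun i => g (i + 1)) (fun i hi => hg (i + 1) (by omega)) hC
    have hp : ∀ τ : ℝ, HasDerivAt
        (fun τ : ℝ => ∑ i ∈ Finset.range (r + 1 + 1), (i ! : ℝ)⁻¹ * g i 0 * τ ^ i)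
        (∑ i ∈ Finset.range (r + 1), (i ! : ℝ)⁻¹ * g (i + 1) 0 * τ ^ i) τ := by
      intro τ
      have h1 : HasDerivAt
          (fun τ : ℝ => ∑ i ∈ Finset.range (r + 1 + 1), (i ! : ℝ)⁻¹ * g i 0 * τ ^ i)
          (∑ i ∈ Finset.range (r + 1 + 1), (i ! : ℝ)⁻¹ * g i 0 * (i * τ ^ (i - 1))) τ :=
        HasDerivAt.fun_sum fun i _ => (hasDerivAt_pow i τ).const_mul _
      convert h1 using 1
      rw [Finset.sum_range_succ' _ (r + 1)]
      simp only [Nat.cast_zero, zero_mul, mul_zero, add_zero, Nat.add_sub_cancel]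
      refine Finset.sum_congr rfl fun i _ => ?_
      rw [Nat.factorial_succ]
      push_cast
      have : (i ! : ℝ) ≠ 0 := by positivity
      field_simp
    have hd : ∀ τ ∈ Set.Icc (0 : ℝ) 1, HasDerivAt
        (fun τ => g 0 τ - ∑ i ∈ Finset.range (r + 1 + 1), (i ! : ℝ)⁻¹ * g i 0 * τ ^ i)
        (g 1 τ - ∑ i ∈ Finset.range (r + 1), (i ! : ℝ)⁻¹ * g (i + 1) 0 * τ ^ i) τ :=
      fun τ hτ => (hg 0 (by omega) τ hτ).sub (hp τ)
    -- The derivative of the remainder is the remainder of order r for the shifted family, bounded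
    -- by Cτ^r/r!; the mean value inequality integrates this to Cτ^{r+1}/(r+1)!.
    refine image_norm_le_of_norm_deriv_right_le_deriv_boundary
      (f' := fun τ => g 1 τ - ∑ i ∈ Finset.range (r + 1), (i ! : ℝ)⁻¹ * g (i + 1) 0 * τ ^ i)
      (B' := fun τ => (r ! : ℝ)⁻¹ * C * τ ^ r)
      (fun τ hτ => (hd τ hτ).continuousAt.continuousWithinAt)
      (fun τ hτ => (hd τ ⟨hτ.1, hτ.2.le⟩).hasDerivWithinAt) ?_ (fun τ => ?_)
      (fun τ hτ => ih' τ ⟨hτ.1, hτ.2.le⟩)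
    · rw [Finset.sum_range_succ']
      simp
    · have hc : (r ! : ℝ)⁻¹ * C * τ ^ r =
          ((r + 1)! : ℝ)⁻¹ * C * (((r + 1 : ℕ) : ℝ) * τ ^ (r + 1 - 1)) := by
        rw [Nat.factorial_succ]
        push_cast
        have : (r ! : ℝ) ≠ 0 := by positivity
        field_simp
      have hder := (hasDerivAt_pow (r + 1) τ).const_mul (((r + 1)! : ℝ)⁻¹ * C)
      rw [← hc] at hder
      exact hder

section Taylor

theorem enorm_sub_le_lipSeminorm {B E : Type*} [NormedAddCommGroup B] [NormedAddCommGroup E]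
    {Θ : Set B} {ρ : ℝ} (hρ : 0 < ρ) (g : B → E)
    {x y : B} (hx : x ∈ Θ) (hy : y ∈ Θ) :
    ‖g x - g y‖ₑ ≤ lipSeminorm ρ Θ g * ‖x - y‖ₑ ^ ρ := by
  rcases eq_or_ne x y with rfl | hxy
  · simp
  have h1 : ‖x - y‖ₑ ≠ 0 := by simpa [sub_eq_zero] using hxy
  rw [← ENNReal.div_le_iff (by simp [h1])
    (ENNReal.rpow_ne_top_of_nonneg hρ.le (by simp))]
  unfold lipSeminorm
  exact le_iSup₂_of_le x hx (le_iSup₂_of_le y hy le_rfl)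

variable {B : Type*} [NormedAddCommGroup B] [NormedSpace ℝ B] {f : B → ℝ} {s : ℕ} {Θ : Set B}
  {ρ : ℝ} {θ t : B}

/-- The remainder of the Taylor expansion at `t`, evaluated at `θ`, of the derivative of `f` along
the multiset `M`. -/
def taylorRem (f : B → ℝ) (s : ℕ) (θ t : B) (M : Multiset B) : ℝ :=
  ∑ i ∈ Finset.range (s - M.card + 1),
    (i ! : ℝ)⁻¹ * multiDeriv f t (M + Multiset.replicate i (θ - t)) - multiDeriv f θ M

/-- Along τ ↦ t + τ(θ - t), each differentiation appends one copy of θ - t to the multiset. After s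
- |M| steps the order is s, and the Hölder seminorm controls the oscillation. -/
theorem enorm_taylorRem_le (hΘ : IsOpen Θ) (hf : ContDiffOn ℝ s f Θ) (hθ : θ ∈ Θ) (ht : t ∈ Θ)
    (hseg : 1 ≤ s → segment ℝ θ t ⊆ Θ) (hρ : 0 < ρ) {M : Multiset B} (hM : M.card ≤ s) :
    ‖taylorRem f s θ t M‖ₑ ≤ ((s - M.card)! : ℝ≥0∞)⁻¹ *
      (lipSeminorm ρ Θ (fun x => iteratedFDeriv ℝ s f x) *
        ‖t - θ‖ₑ ^ (((s - M.card : ℕ) : ℝ) + ρ)) * (M.map fun y => ‖y‖ₑ).prod := by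
  set L := lipSeminorm ρ Θ (fun x => iteratedFDeriv ℝ s f x) with hL
  set r := s - M.card with hr
  set h := θ - t with hh
  set C : ℝ≥0∞ := L * ‖h‖ₑ ^ ρ * ((M.map fun y => ‖y‖ₑ).prod * ‖h‖ₑ ^ r) with hC
  have hth : ‖t - θ‖ₑ = ‖h‖ₑ := by rw [hh, ← enorm_neg, neg_sub]
  have hRHS : (r ! : ℝ≥0∞)⁻¹ * (L * ‖t - θ‖ₑ ^ ((r : ℝ) + ρ)) * (M.map fun y => ‖y‖ₑ).prod =
      (r ! : ℝ≥0∞)⁻¹ * C := by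
    rw [hth, ENNReal.rpow_add_of_nonneg _ _ (by positivity) hρ.le, ENNReal.rpow_natCast, hC]
    ring
  rw [hRHS]
  let g : ℕ → ℝ → ℝ := fun i τ => multiDeriv f (t + τ • h) (M + Multiset.replicate i h)
  have hg_zero : ∀ i, g i 0 = multiDeriv f t (M + Multiset.replicate i h) := fun i => by simp [g]
  have hg_one : g 0 1 = multiDeriv f θ M := by simp [g, hh]
  have hosc : ∀ τ ∈ Set.Icc (0 : ℝ) 1, t + τ • h ∈ Θ → ‖g r τ - g r 0‖ₑ ≤ C := by
    intro τ hτ hmem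
    rw [hg_zero]
    refine (enorm_multiDeriv_sub_le f (t + τ • h) t (k := s) (by simp; omega)).trans ?_
    have h1 := enorm_sub_le_lipSeminorm hρ (fun x => iteratedFDeriv ℝ s f x) hmem ht
    rw [hC, Multiset.map_add, Multiset.prod_add, Multiset.map_replicate, Multiset.prod_replicate]
    gcongr
    refine h1.trans ?_
    rw [← hL]
    gcongr
    rw [add_sub_cancel_left, enorm_smul]
    calc ‖τ‖ₑ * ‖h‖ₑ ≤ 1 * ‖h‖ₑ := by
          gcongr
          rw [Real.enorm_eq_ofReal hτ.1]
          exact ENNReal.ofReal_le_one.2 hτ.2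
      _ = ‖h‖ₑ := one_mul _
  have hrem : ∀ c : ℝ, |g 0 1 - ∑ i ∈ Finset.range (r + 1), (i ! : ℝ)⁻¹ * g i 0 * 1 ^ i| ≤ c →
      ‖taylorRem f s θ t M‖ₑ ≤ ENNReal.ofReal c := by
    intro c hc
    rw [← ofReal_norm, Real.norm_eq_abs, abs_sub_comm] at *
    refine ENNReal.ofReal_le_ofReal (le_trans (le_of_eq ?_) hc)
    rw [hg_one, taylorRem]
    simp only [hg_zero, one_pow, mul_one]
    rfl
  by_cases hCtop : C = ∞
  · rw [hCtop, ENNReal.mul_top (by simp)]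
    exact le_top
  have hreal : ∀ τ ∈ Set.Icc (0 : ℝ) 1, t + τ • h ∈ Θ → |g r τ - g r 0| ≤ C.toReal := by
    intro τ hτ hmem
    have := ENNReal.toReal_mono hCtop (hosc τ hτ hmem)
    simpa using this
  have hfin : (r ! : ℝ≥0∞)⁻¹ * C = ENNReal.ofReal ((r ! : ℝ)⁻¹ * C.toReal * 1 ^ r) := by
    rw [one_pow, mul_one, ENNReal.ofReal_mul (by positivity), ENNReal.ofReal_toReal hCtop,
      ENNReal.ofReal_inv_of_pos (by positivity), ENNReal.ofReal_natCast]
  rw [hfin]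
  refine hrem _ ?_
  -- For r = 0 only the endpoint τ = 1, that is θ, is used, so no segment condition is required; it
  -- is unavailable when s = 0.
  rcases Nat.eq_zero_or_pos r with hr0 | hrpos
  · have := hreal 1 (by simp) (by simpa [hh] using hθ)
    rw [hr0] at this ⊢
    simpa using this
  have hsub := hseg (by omega)
  have hline : ∀ τ ∈ Set.Icc (0 : ℝ) 1, t + τ • h ∈ Θ := by
    intro τ hτ
    refine hsub ?_
    rw [segment_symm]
    exact ⟨1 - τ, τ, by linarith [hτ.2], hτ.1, by ring, by rw [hh]; module⟩
  refine taylor_bound_of_hasDerivAt r g (fun i hi τ hτ => ?_) (fun τ hτ => hreal τ hτ (hline τ hτ))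
    1 (by simp)
  have hcd : ContDiffAt ℝ s f (t + τ • h) := hf.contDiffAt (hΘ.mem_nhds (hline τ hτ))
  have := hasDerivAt_multiDeriv_line hcd (M := M + Multiset.replicate i h) (by simp; omega)
  convert this using 1
  simp [g, Multiset.replicate_succ]

end Taylor

/-! ### Algebra: the one-sided error as a sum of Taylor remainders over index sets. -/

section Decomposition

variable {B : Type*} [NormedAddCommGroup B] [NormedSpace ℝ B] {f : B → ℝ} {s n : ℕ} {t : B}

theorem sum_strictMono_eq_sum_powersetCard {k : ℕ} (F : Multiset (Fin n) → ℝ)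
    [DecidablePred fun J : Fin k → Fin n => StrictMono J] :
    ∑ J : Fin k → Fin n with StrictMono J, F (Finset.univ.val.map J) =
      ∑ A ∈ Finset.powersetCard k (Finset.univ : Finset (Fin n)), F A.val := by
  refine Finset.sum_bij' (fun J _ => Finset.univ.image J)
    (fun A hA => A.orderEmbOfFin (Finset.mem_powersetCard.1 hA).2) ?_ ?_ ?_ ?_ ?_
  · intro J hJ
    have hJ' := (Finset.mem_filter.1 hJ).2
    rw [Finset.mem_powersetCard]
    exact ⟨Finset.subset_univ _, by simp [Finset.card_image_of_injective _ hJ'.injective]⟩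
  · intro A hA
    simpa using (A.orderEmbOfFin _).strictMono
  · intro J hJ
    have hJ' := (Finset.mem_filter.1 hJ).2
    exact (Finset.orderEmbOfFin_unique _ (by simp) hJ').symm
  · intro A hA
    exact Finset.image_orderEmbOfFin_univ A _
  · intro J hJ
    have hJ' := (Finset.mem_filter.1 hJ).2
    rw [Finset.image_val_of_injOn hJ'.injective.injOn]

theorem uStat_eq_sum_powersetCard {x : B} (hf : ContDiffAt ℝ s f x) {k : ℕ} (hk : k ≤ s)
    (w : Fin n → B) (b : B) :
    uStat w b (iteratedFDeriv ℝ k f x) = ((n.choose k : ℕ) : ℝ)⁻¹ *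
      ∑ A ∈ Finset.powersetCard k (Finset.univ : Finset (Fin n)),
        multiDeriv f x (A.val.map fun i => w i - b) := by
  classical
  rw [← sum_strictMono_eq_sum_powersetCard
    (fun S => multiDeriv f x (S.map fun i => w i - b)), uStat]
  congr 1
  refine Finset.sum_congr (by congr) fun J _ => ?_
  rw [Multiset.map_map, ← multiDeriv_univ_map hf hk]
  rfl

theorem sum_range_powersetCard {α : Type*} [AddCommMonoid α] (F : ℕ → Finset (Fin n) → α) :
    ∑ k ∈ Finset.range (s + 1), ∑ A ∈ Finset.powersetCard k (Finset.univ : Finset (Fin n)), F k A =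
      ∑ R : Finset (Fin n) with R.card ≤ s, F R.card R := by
  rw [← Finset.sum_fiberwise_of_maps_to (s := Finset.univ.filter fun R : Finset (Fin n) => R.card ≤ s)
    (t := Finset.range (s + 1)) (g := Finset.card) (by simp)]
  refine Finset.sum_congr rfl fun k hk => ?_
  have hk' := Finset.mem_range.1 hk
  refine Finset.sum_congr ?_ ?_
  · ext A
    simp [Finset.mem_powersetCard]
    omega
  · intro A hA
    rw [(Finset.mem_filter.1 hA).2]

theorem oneSided_eq_sum {x : B} (hf : ContDiffAt ℝ s f x) (w : Fin n → B) (b : B) :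
    f x + ∑ k ∈ Finset.Icc 1 s, ((k ! : ℕ) : ℝ)⁻¹ * uStat w b (iteratedFDeriv ℝ k f x) =
      ∑ k ∈ Finset.range (s + 1), ∑ A ∈ Finset.powersetCard k (Finset.univ : Finset (Fin n)),
        ((k ! : ℝ) * n.choose k)⁻¹ * multiDeriv f x (A.val.map fun i => w i - b) := by
  rw [Finset.sum_range_succ', add_comm (f x)]
  congr 1
  · rw [Finset.range_eq_Ico, Finset.sum_Ico_add' (fun k =>
      ∑ A ∈ Finset.powersetCard k (Finset.univ : Finset (Fin n)),
        ((k ! : ℝ) * n.choose k)⁻¹ * multiDeriv f x (A.val.map fun i => w i - b))]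
    refine Finset.sum_congr (by ext; simp) fun k hk => ?_
    rw [uStat_eq_sum_powersetCard hf (by simp at hk; omega), ← Finset.mul_sum, mul_inv, mul_assoc]
  · simp

/-- After expanding around θ, the term of R does not depend on the k-set A ⊇ R it came from; the
binomial coefficient counts these A. -/
theorem sum_powersetCard_multiDeriv (hf : ContDiffAt ℝ s f t) {k : ℕ} (hk : k ≤ s) (w : Fin n → B)
    (θ : B) :
    ∑ A ∈ Finset.powersetCard k (Finset.univ : Finset (Fin n)),
        multiDeriv f t (A.val.map fun i => w i - t) =
      ∑ R : Finset (Fin n) with R.card ≤ k, ((n - R.card).choose (k - R.card) : ℝ) *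
        multiDeriv f t ((R.val.map fun i => w i - θ) +
          Multiset.replicate (k - R.card) (θ - t)) := by
  have h1 : ∀ A ∈ Finset.powersetCard k (Finset.univ : Finset (Fin n)),
      multiDeriv f t (A.val.map fun i => w i - t) = ∑ R ∈ A.powerset,
        multiDeriv f t ((R.val.map fun i => w i - θ) +
          Multiset.replicate (k - R.card) (θ - t)) := by
    intro A hA
    have hA' := (Finset.mem_powersetCard.1 hA).2
    have := multiDeriv_map_add hf (fun i => w i - θ) (θ - t) A 0 (by simp; omega)
    simpa [hA'] using this
  rw [Finset.sum_congr rfl h1, Finset.sum_comm' (t' := Finset.univ.filter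
    fun R : Finset (Fin n) => R.card ≤ k)
    (s' := fun R => (Finset.powersetCard k (Finset.univ : Finset (Fin n))).filter fun A => R ⊆ A)]
  · refine Finset.sum_congr rfl fun R hR => ?_
    rw [Finset.sum_const, nsmul_eq_mul]
    congr 2
    rw [Finset.card_filter_powersetCard_subset _ _ _ (Finset.subset_univ R)
      (Finset.mem_filter.1 hR).2]
    simp
  · intro A R
    simp only [Finset.mem_powersetCard, Finset.mem_powerset, Finset.mem_filter, Finset.mem_univ,
      Finset.subset_univ, true_and]
    constructor
    · rintro ⟨h1, h2⟩
      exact ⟨⟨h1, h2⟩, h1 ▸ Finset.card_le_card h2⟩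
    · rintro ⟨⟨h1, h2⟩, -⟩
      exact ⟨h1, h2⟩

/-- The identity that makes the estimator work: the weight of degree j + i, times the number of (j +
i)-sets over a given j-set, splits into the weight of degree j and the Taylor coefficient 1/i!. -/
theorem inv_factorial_choose_mul {j i : ℕ} (h : j + i ≤ n) :
    (((j + i)! : ℝ) * n.choose (j + i))⁻¹ * ((n - j).choose i : ℝ) =
      ((j ! : ℝ) * n.choose j)⁻¹ * (i ! : ℝ)⁻¹ := by
  have h1 : n.choose (j + i) * (j + i).choose j = n.choose j * (n - j).choose i := by
    have := Nat.choose_mul (n := n) (k := j + i) (s := j) (by omega)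
    simpa using this
  have h2 : (j + i).choose j * j ! * i ! = (j + i)! := by
    rw [Nat.choose_symm_add]
    exact Nat.add_choose_mul_factorial_mul_factorial j i
  have h3 : (n.choose j : ℝ) ≠ 0 := by exact_mod_cast (Nat.choose_pos (by omega)).ne'
  have h4 : (n.choose (j + i) : ℝ) ≠ 0 := by exact_mod_cast (Nat.choose_pos h).ne'
  have h1' : (n.choose (j + i) : ℝ) * (j + i).choose j = n.choose j * (n - j).choose i := by
    exact_mod_cast h1
  have h2' : ((j + i).choose j : ℝ) * j ! * i ! = (j + i)! := by exact_mod_cast h2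
  have h5 : (j ! : ℝ) ≠ 0 := by positivity
  have h6 : (i ! : ℝ) ≠ 0 := by positivity
  have h7 : ((j + i)! : ℝ) ≠ 0 := by positivity
  field_simp
  rw [← h2']
  linear_combination (-(j ! : ℝ) * i !) * h1'

/-- The error of the one-sided estimator, after subtraction of the U-statistics of the derivatives
at `θ`, is a sum of Taylor remainders indexed by subsets of the sample. -/
theorem oneSided_sub_eq_sum_taylorRem {θ : B} (hft : ContDiffAt ℝ s f t)
    (hfθ : ContDiffAt ℝ s f θ) (hsn : s ≤ n) (w : Fin n → B) :
    oneSided f s w t -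
        (f θ + ∑ k ∈ Finset.Icc 1 s, ((k ! : ℕ) : ℝ)⁻¹ * uStat w θ (iteratedFDeriv ℝ k f θ)) =
      ∑ R : Finset (Fin n) with R.card ≤ s, ((R.card ! : ℝ) * n.choose R.card)⁻¹ *
        taylorRem f s θ t (R.val.map fun i => w i - θ) := by
  have h1 : oneSided f s w t = ∑ R : Finset (Fin n) with R.card ≤ s,
      ((R.card ! : ℝ) * n.choose R.card)⁻¹ * ∑ i ∈ Finset.range (s - R.card + 1), (i ! : ℝ)⁻¹ *
        multiDeriv f t ((R.val.map fun i => w i - θ) + Multiset.replicate i (θ - t)) := by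
    rw [oneSided, oneSided_eq_sum hft]
    simp_rw [← Finset.mul_sum]
    rw [Finset.sum_congr rfl fun k hk => by
      rw [sum_powersetCard_multiDeriv hft (Nat.lt_succ_iff.1 (Finset.mem_range.1 hk)) w θ,
        Finset.mul_sum]]
    rw [Finset.sum_comm' (t' := Finset.univ.filter fun R : Finset (Fin n) => R.card ≤ s)
      (s' := fun R => Finset.Ico R.card (s + 1)) (by intro k R; simp; omega)]
    refine Finset.sum_congr rfl fun R hR => ?_
    have hR' := (Finset.mem_filter.1 hR).2
    rw [Finset.sum_Ico_eq_sum_range, Finset.mul_sum, Nat.sub_add_comm hR']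
    refine Finset.sum_congr rfl fun i hi => ?_
    have hi' := Finset.mem_range.1 hi
    rw [Nat.add_sub_cancel_left, ← mul_assoc, inv_factorial_choose_mul (by omega), mul_assoc]
  rw [h1, oneSided_eq_sum hfθ, sum_range_powersetCard (fun k A =>
    ((k ! : ℝ) * n.choose k)⁻¹ * multiDeriv f θ (A.val.map fun i => w i - θ)),
    ← Finset.sum_sub_distrib]
  refine Finset.sum_congr rfl fun R _ => ?_
  rw [← mul_sub, taylorRem]
  simp

end Decomposition

/-! ### Product measures and replacement of one coordinate. -/

section Resampling

/-- Replacing one coordinate of an i.i.d. sample by an independent copy preserves its law. -/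
theorem measurePreserving_update {ι E : Type*} [Fintype ι] [DecidableEq ι] [MeasurableSpace E]
    (P : Measure E) [IsProbabilityMeasure P] (i : ι) :
    MeasurePreserving (fun p : (ι → E) × E => Function.update p.1 i p.2)
      ((Measure.pi fun _ : ι => P).prod P) (Measure.pi fun _ : ι => P) := by
  have hm : Measurable fun p : (ι → E) × E => Function.update p.1 i p.2 := by
    rw [measurable_pi_iff]
    intro j
    rcases eq_or_ne j i with rfl | hj
    · simpa using measurable_snd
    · simp only [Function.update_of_ne hj]
      fun_prop
  refine ⟨hm, (Measure.pi_eq fun S hS => ?_).symm⟩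
  rw [Measure.map_apply hm (MeasurableSet.univ_pi hS)]
  have : (fun p : (ι → E) × E => Function.update p.1 i p.2) ⁻¹' Set.univ.pi S =
      (Set.univ.pi (Function.update S i Set.univ)) ×ˢ S i := by
    ext ⟨x, y⟩
    simp only [Set.mem_preimage, Set.mem_univ_pi, Set.mem_prod]
    constructor
    · intro h
      refine ⟨fun j => ?_, by simpa using h i⟩
      rcases eq_or_ne j i with rfl | hj
      · simp
      · simpa [hj] using h j
    · rintro ⟨h1, h2⟩ j
      rcases eq_or_ne j i with rfl | hj
      · simpa using h2
      · simpa [hj] using h1 j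
  rw [this, Measure.prod_prod, Measure.pi_pi, ← Finset.mul_prod_erase _ _ (Finset.mem_univ i),
    ← Finset.mul_prod_erase (Finset.univ) (fun j => P (S j)) (Finset.mem_univ i)]
  simp only [Function.update_self, measure_univ, one_mul]
  rw [mul_comm]
  congr 1
  refine Finset.prod_congr rfl fun j hj => ?_
  rw [Function.update_of_ne (Finset.ne_of_mem_erase hj)]

variable {ι E : Type*} [Fintype ι] [DecidableEq ι] [MeasurableSpace E]
  (P : Measure E) [IsProbabilityMeasure P]

/-- Allows integrating in one coordinate with the others frozen, without splitting the product
space. -/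
theorem lintegral_pi_eq_update (i : ι) {F : (ι → E) → ℝ≥0∞} (hF : Measurable F) :
    ∫⁻ x, F x ∂(Measure.pi fun _ : ι => P) =
      ∫⁻ x, ∫⁻ y, F (Function.update x i y) ∂P ∂(Measure.pi fun _ : ι => P) := by
  have h := measurePreserving_update (ι := ι) P i
  rw [← h.lintegral_comp hF]
  exact lintegral_prod _ (hF.comp h.measurable).aemeasurable

theorem lintegral_pi_prod_finset {g : E → ℝ≥0∞} (hg : Measurable g) (S : Finset ι) :
    ∫⁻ x, ∏ l ∈ S, g (x l) ∂(Measure.pi fun _ : ι => P) = (∫⁻ y, g y ∂P) ^ S.card := by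
  induction S using Finset.induction_on with
  | empty => simp
  | @insert i S hi ih =>
    have hm : ∀ T : Finset ι, Measurable fun x : ι → E => ∏ l ∈ T, g (x l) := fun T =>
      Finset.measurable_prod _ fun l _ => hg.comp (measurable_pi_apply l)
    rw [lintegral_pi_eq_update P i (hm _)]
    have h1 : ∀ (x : ι → E) (y : E), ∏ l ∈ insert i S, g (Function.update x i y l) =
        g y * ∏ l ∈ S, g (x l) := by
      intro x y
      rw [Finset.prod_insert hi, Function.update_self]
      congr 1
      refine Finset.prod_congr rfl fun l hl => ?_
      rw [Function.update_of_ne (ne_of_mem_of_not_mem hl hi)]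
    simp_rw [h1, lintegral_mul_const _ hg]
    rw [lintegral_const_mul _ (hm _), ih, Finset.card_insert_of_notMem hi, pow_succ, mul_comm]

end Resampling

/-! ### Second moments and orthogonality of forms in centred sample points. -/

section Variance

variable {B : Type*} [NormedAddCommGroup B] [NormedSpace ℝ B]
  [MeasurableSpace B] (P : Measure B)

theorem lintegral_dual_sq_le_opNorm (u : StrongDual ℝ B) :
    ∫⁻ w, ‖u (w - mean P)‖ₑ ^ 2 ∂P ≤ ‖u‖ₑ ^ 2 * weakVar P := by
  rcases eq_or_ne u 0 with rfl | hu
  · simp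
  have hu' : ‖u‖ ≠ 0 := norm_ne_zero_iff.2 hu
  have h1 : ∀ z, ‖u z‖ₑ ^ 2 = ‖u‖ₑ ^ 2 * ‖(‖u‖⁻¹ • u) z‖ₑ ^ 2 := by
    intro z
    have : u z = ‖u‖ * (‖u‖⁻¹ • u) z := by
      simp [hu']
    rw [this, enorm_mul, mul_pow, enorm_norm]
  simp_rw [h1]
  rw [lintegral_const_mul' _ _ (by simp)]
  gcongr
  exact le_iSup₂_of_le (‖u‖⁻¹ • u) (by rw [norm_smul]; simp [hu']) le_rfl

/-- κ may be infinite, which matters because L may be. In that case only ν = 0 needs an argument,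
and the operator norm version then gives 0. -/
theorem lintegral_dual_sq_le {u : StrongDual ℝ B} {κ : ℝ≥0∞} (h : ∀ y, ‖u y‖ₑ ≤ κ * ‖y‖ₑ) :
    ∫⁻ w, ‖u (w - mean P)‖ₑ ^ 2 ∂P ≤ κ ^ 2 * weakVar P := by
  have h0 := lintegral_dual_sq_le_opNorm P u
  rcases eq_or_ne κ ∞ with rfl | hκ
  · rcases eq_or_ne (weakVar P) 0 with hν | hν
    · simpa [hν] using h0
    · rw [ENNReal.top_pow two_ne_zero, ENNReal.top_mul hν]
      exact le_top
  · refine h0.trans ?_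
    gcongr
    have : ‖u‖ ≤ κ.toReal := by
      refine u.opNorm_le_bound ENNReal.toReal_nonneg fun y => ?_
      have := ENNReal.toReal_mono (ENNReal.mul_ne_top hκ (by simp)) (h y)
      simpa using this
    rw [← ofReal_norm, ← ENNReal.ofReal_toReal hκ]
    exact ENNReal.ofReal_le_ofReal this

variable [IsProbabilityMeasure P]

theorem integral_dual_sub_mean [CompleteSpace B] (hP : Integrable (fun w : B => w) P) (u : StrongDual ℝ B) :
    ∫ w, u (w - mean P) ∂P = 0 := by
  have h : Integrable (fun w => w - mean P) P := hP.sub (integrable_const _)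
  rw [u.integral_comp_comm h, integral_sub hP (integrable_const _)]
  simp [mean]

variable {ι : Type*} [Fintype ι] [DecidableEq ι]

/-- Second moment of a form that is linear in one centred sample point and multilinearly bounded. -/
theorem lintegral_sq_le_of_bound [BorelSpace B] [TopologicalSpace.SeparableSpace B]
    {R : Finset ι} {i : ι} (hi : i ∈ R) {Y : (ι → B) → ℝ}
    (hY : Measurable Y)
    (hlin : ∀ x, ∃ u : StrongDual ℝ B, ∀ y, Y (Function.update x i y) = u (y - mean P))
    {K : ℝ≥0∞} (hK : ∀ x, ‖Y x‖ₑ ≤ K * ∏ l ∈ R, ‖x l - mean P‖ₑ) :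
    ∫⁻ x, ‖Y x‖ₑ ^ 2 ∂(Measure.pi fun _ : ι => P) ≤
      K ^ 2 * weakVar P * strongVar P ^ (R.card - 1) := by
  have : SecondCountableTopology B := UniformSpace.secondCountable_of_separable B
  have hg : Measurable fun y : B => ‖y - mean P‖ₑ ^ 2 := by fun_prop
  rw [lintegral_pi_eq_update P i (by fun_prop)]
  calc _ ≤ ∫⁻ x : ι → B, K ^ 2 * weakVar P * ∏ l ∈ R.erase i, ‖x l - mean P‖ₑ ^ 2
        ∂(Measure.pi fun _ : ι => P) := by
        refine lintegral_mono fun x => ?_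
        obtain ⟨u, hu⟩ := hlin x
        simp_rw [hu]
        refine (lintegral_dual_sq_le P (κ := K * ∏ l ∈ R.erase i, ‖x l - mean P‖ₑ) ?_).trans_eq ?_
        · intro z
          -- Evaluating at the shifted point z + θ turns the bound on Y into a bound on the
          -- functional u at z, with the norms of the other points as constant.
          have h1 := hK (Function.update x i (z + mean P))
          rw [hu, ← Finset.mul_prod_erase _ _ hi] at h1
          simp only [Function.update_self, add_sub_cancel_right] at h1
          refine h1.trans_eq ?_
          rw [Finset.prod_congr rfl fun l hl => by
            rw [Function.update_of_ne (Finset.ne_of_mem_erase hl)]]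
          ring
        · rw [mul_pow, Finset.prod_pow]
          ring
    _ = _ := by
        rw [lintegral_const_mul _ (by fun_prop), lintegral_pi_prod_finset P hg,
          Finset.card_erase_of_mem hi, strongVar]

/-- Integrate in coordinate i first: Z is constant there, and Y is a functional of a centred
variable. -/
theorem integral_mul_eq_zero [CompleteSpace B] (hP : Integrable (fun w : B => w) P) {i : ι} {Y Z : (ι → B) → ℝ}
    (hYZ : Integrable (fun x => Y x * Z x) (Measure.pi fun _ : ι => P))
    (hlin : ∀ x, ∃ u : StrongDual ℝ B, ∀ y, Y (Function.update x i y) = u (y - mean P))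
    (hind : ∀ x y, Z (Function.update x i y) = Z x) :
    ∫ x, Y x * Z x ∂(Measure.pi fun _ : ι => P) = 0 := by
  have h := measurePreserving_update (ι := ι) P i
  have hint : Integrable (fun p : (ι → B) × B => Y (Function.update p.1 i p.2) *
      Z (Function.update p.1 i p.2)) ((Measure.pi fun _ : ι => P).prod P) :=
    h.integrable_comp_of_integrable hYZ
  have h2 : ∫ x, Y x * Z x ∂(Measure.pi fun _ : ι => P) =
      ∫ p : (ι → B) × B, Y (Function.update p.1 i p.2) * Z (Function.update p.1 i p.2)
        ∂((Measure.pi fun _ : ι => P).prod P) := by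
    have h3 := h.map_eq
    conv_lhs => rw [← h3]
    rw [integral_map h.measurable.aemeasurable]
    rw [h3]
    exact hYZ.aestronglyMeasurable
  rw [h2, integral_prod _ hint]
  refine integral_eq_zero_of_ae (Filter.Eventually.of_forall fun x => ?_)
  obtain ⟨u, hu⟩ := hlin x
  simp only [hu, hind, Pi.zero_apply]
  rw [integral_mul_const, integral_dual_sub_mean P hP u, zero_mul]

/-- Forms in distinct sets of sample points, linear in each centred point, are orthogonal. -/
theorem lintegral_sq_sum_le [CompleteSpace B] (hP : Integrable (fun w : B => w) P) (𝓡 : Finset (Finset ι))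
    {Y : Finset ι → (ι → B) → ℝ} (hY : ∀ R ∈ 𝓡, Measurable (Y R))
    (hlin : ∀ R ∈ 𝓡, ∀ i ∈ R, ∀ x, ∃ u : StrongDual ℝ B,
      ∀ y, Y R (Function.update x i y) = u (y - mean P))
    (hind : ∀ R ∈ 𝓡, ∀ i ∉ R, ∀ x y, Y R (Function.update x i y) = Y R x) :
    ∫⁻ x, ‖∑ R ∈ 𝓡, Y R x‖ₑ ^ 2 ∂(Measure.pi fun _ : ι => P) ≤
      ∑ R ∈ 𝓡, ∫⁻ x, ‖Y R x‖ₑ ^ 2 ∂(Measure.pi fun _ : ι => P) := by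
  set π := Measure.pi fun _ : ι => P
  -- An infinite second moment makes the claim trivial; otherwise all terms are in L² and the cross
  -- products are integrable.
  by_cases htop : ∃ R ∈ 𝓡, ∫⁻ x, ‖Y R x‖ₑ ^ 2 ∂π = ∞
  · obtain ⟨R, hR, h⟩ := htop
    rw [(ENNReal.sum_eq_top (s := 𝓡) (f := fun R => ∫⁻ x, ‖Y R x‖ₑ ^ 2 ∂π)).2 ⟨R, hR, h⟩]
    exact le_top
  push Not at htop
  have hL2 : ∀ R ∈ 𝓡, MemLp (Y R) 2 π := by
    intro R hR
    refine ⟨(hY R hR).aestronglyMeasurable, ?_⟩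
    rw [eLpNorm_lt_top_iff_lintegral_rpow_enorm_lt_top two_ne_zero ENNReal.ofNat_ne_top]
    simpa using (htop R hR).lt_top
  have hint : ∀ R ∈ 𝓡, ∀ R' ∈ 𝓡, Integrable (fun x => Y R x * Y R' x) π :=
    fun R hR R' hR' => (hL2 R hR).integrable_mul (hL2 R' hR')
  have hsq : ∀ Z : (ι → B) → ℝ, Integrable (fun x => Z x * Z x) π →
      ∫⁻ x, ‖Z x‖ₑ ^ 2 ∂π = ENNReal.ofReal (∫ x, Z x * Z x ∂π) := by
    intro Z hZ
    rw [ofReal_integral_eq_lintegral_ofReal hZ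
      (Filter.Eventually.of_forall fun x => mul_self_nonneg (Z x))]
    refine lintegral_congr fun x => ?_
    rw [← sq, ← sq_abs, ENNReal.ofReal_pow (abs_nonneg _), ← Real.norm_eq_abs, ofReal_norm]
  have hcross : ∀ R ∈ 𝓡, ∀ R' ∈ 𝓡, R' ≠ R → ∫ x, Y R x * Y R' x ∂π = 0 := by
    intro R hR R' hR' hne
    -- Two different sets have an index in one but not in the other; that coordinate kills the cross
    -- term.
    by_cases hsub : R ⊆ R'
    · have : ¬ R' ⊆ R := fun h => hne (h.antisymm hsub)
      obtain ⟨i, hi, hi'⟩ := Finset.not_subset.1 this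
      simp_rw [mul_comm (Y R _)]
      exact integral_mul_eq_zero P hP (hint R' hR' R hR) (hlin R' hR' i hi) (hind R hR i hi')
    · obtain ⟨i, hi, hi'⟩ := Finset.not_subset.1 hsub
      exact integral_mul_eq_zero P hP (hint R hR R' hR') (hlin R hR i hi) (hind R' hR' i hi')
  have hexp : ∀ x, (∑ R ∈ 𝓡, Y R x) * (∑ R ∈ 𝓡, Y R x) = ∑ R ∈ 𝓡, ∑ R' ∈ 𝓡, Y R x * Y R' x :=
    fun x => Finset.sum_mul_sum _ _ _ _
  have hintS : Integrable (fun x => (∑ R ∈ 𝓡, Y R x) * (∑ R ∈ 𝓡, Y R x)) π := by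
    simp_rw [hexp]
    exact integrable_finsetSum _ fun R hR => integrable_finsetSum _ fun R' hR' => hint R hR R' hR'
  rw [hsq _ hintS, Finset.sum_congr rfl fun R hR => hsq (Y R) (hint R hR R hR),
    ← ENNReal.ofReal_sum_of_nonneg fun R _ => integral_nonneg fun x => mul_self_nonneg _]
  refine le_of_eq (congrArg ENNReal.ofReal ?_)
  simp_rw [hexp]
  rw [integral_finsetSum _ fun R hR => integrable_finsetSum _ fun R' hR' => hint R hR R' hR']
  refine Finset.sum_congr rfl fun R hR => ?_
  rw [integral_finsetSum _ fun R' hR' => hint R hR R' hR']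
  exact Finset.sum_eq_single_of_mem R hR fun R' hR' hne => hcross R hR R' hR' hne

end Variance

/-! ### Combinatorial constants. -/

theorem pow_le_factorial_mul_descFactorial {n k : ℕ} (hk : k ≤ n) :
    n ^ k ≤ k ! * n.descFactorial k := by
  induction k with
  | zero => simp
  | succ k ih =>
    -- Two positive integers have product at least their sum minus one; here they are k + 1 and n -
    -- k.
    have h1 : n ≤ (k + 1) * (n - k) := by
      obtain ⟨d, rfl⟩ := Nat.exists_eq_add_of_le hk
      rw [show k + 1 + d - k = d + 1 by omega]
      nlinarith
    calc n ^ (k + 1) = n * n ^ k := by ring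
      _ ≤ ((k + 1) * (n - k)) * (k ! * n.descFactorial k) := Nat.mul_le_mul h1 (ih (by omega))
      _ = (k + 1)! * n.descFactorial (k + 1) := by
        rw [Nat.descFactorial_succ, Nat.factorial_succ]
        ring

/-- The left side equals 1/(k! · k! C(n,k)), and k! C(n,k) is the descending factorial of n. One of
the two factorials compensates for the gap between it and n^k. -/
theorem choose_mul_enorm_sq_le {n k : ℕ} (hk : k ≤ n) :
    (n.choose k : ℝ≥0∞) * ‖((k ! : ℝ) * n.choose k)⁻¹‖ₑ ^ 2 ≤ ((n : ℝ≥0∞)⁻¹) ^ k := by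
  have hc : 0 < (n.choose k : ℝ) := by exact_mod_cast Nat.choose_pos hk
  have hk0 : 0 < (k ! : ℝ) := by positivity
  rcases Nat.eq_zero_or_pos n with rfl | hn
  · obtain rfl : k = 0 := by omega
    simp
  have hn' : 0 < (n : ℝ) := by exact_mod_cast hn
  have key : (n.choose k : ℝ) * (((k ! : ℝ) * n.choose k)⁻¹) ^ 2 ≤ ((n : ℝ)⁻¹) ^ k := by
    have h1 : (n : ℝ) ^ k ≤ k ! * (k ! * n.choose k) := by
      exact_mod_cast (Nat.descFactorial_eq_factorial_mul_choose n k) ▸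
        pow_le_factorial_mul_descFactorial hk
    have h2 : (n.choose k : ℝ) * (((k ! : ℝ) * n.choose k)⁻¹) ^ 2 =
        (k ! * (k ! * n.choose k) : ℝ)⁻¹ := by
      field_simp
    rw [h2, inv_pow]
    exact inv_anti₀ (by positivity) h1
  have h := ENNReal.ofReal_le_ofReal key
  rwa [ENNReal.ofReal_mul hc.le, ENNReal.ofReal_pow (by positivity), ENNReal.ofReal_pow (by positivity),
    ENNReal.ofReal_natCast, ENNReal.ofReal_inv_of_pos hn', ENNReal.ofReal_natCast,
    ← Real.enorm_eq_ofReal (by positivity)] at h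

/-- Adding up the second moments over all `k`-element sets of sample points. -/
theorem sum_powersetCard_variance_le {n k : ℕ} (hk1 : 1 ≤ k) (hk : k ≤ n) (K ν V : ℝ≥0∞) :
    ∑ _A ∈ Finset.powersetCard k (Finset.univ : Finset (Fin n)),
        (‖((k ! : ℝ) * n.choose k)⁻¹‖ₑ * K) ^ 2 * ν * V ^ (k - 1) ≤
      K ^ 2 * (ν / n * (V / n) ^ (k - 1)) := by
  rw [Finset.sum_const, Finset.card_powersetCard, Finset.card_univ, Fintype.card_fin, nsmul_eq_mul]
  calc _ = (n.choose k : ℝ≥0∞) * ‖((k ! : ℝ) * n.choose k)⁻¹‖ₑ ^ 2 * (K ^ 2 * ν * V ^ (k - 1)) := by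
        ring
    _ ≤ ((n : ℝ≥0∞)⁻¹) ^ k * (K ^ 2 * ν * V ^ (k - 1)) := by
        gcongr
        exact choose_mul_enorm_sq_le hk
    _ = _ := by
        obtain ⟨j, rfl⟩ := Nat.exists_eq_add_of_le' hk1
        simp only [div_eq_mul_inv, Nat.add_sub_cancel, mul_pow]
        ring

/-- Read backwards, this is a partial sum of the exponential series at 1: the source of the constant
e. -/
theorem sum_range_inv_factorial_le (s : ℕ) :
    ∑ k ∈ Finset.range s, ((s - (k + 1))! : ℝ≥0∞)⁻¹ ≤ ENNReal.ofReal (Real.exp 1) := by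
  have h0 : ∀ i : ℕ, (i ! : ℝ≥0∞)⁻¹ = ENNReal.ofReal ((1 : ℝ) ^ i / i !) := by
    intro i
    rw [one_pow, one_div, ENNReal.ofReal_inv_of_pos (by positivity), ENNReal.ofReal_natCast]
  have h1 := Finset.sum_range_reflect (fun i => (i ! : ℝ≥0∞)⁻¹) s
  simp only [Nat.sub_sub, add_comm 1] at h1
  rw [h1, Finset.sum_congr rfl fun i _ => h0 i,
    ← ENNReal.ofReal_sum_of_nonneg fun i _ => by positivity]
  exact ENNReal.ofReal_le_ofReal (Real.sum_le_exp_of_nonneg zero_le_one s)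

/-! ### Centred points of a subset after one coordinate is replaced. -/

section Sample

variable {B : Type*} [NormedAddCommGroup B] {ι : Type*}

theorem map_update_of_mem [DecidableEq ι] {R : Finset ι} {i : ι} (hi : i ∈ R) (x : ι → B) (y θ : B) :
    (R.val.map fun l => Function.update x i y l - θ) =
      (y - θ) ::ₘ ((R.erase i).val.map fun l => x l - θ) := by
  conv_lhs => rw [← Finset.insert_erase hi]
  rw [Finset.insert_val_of_notMem (by simp), Multiset.map_cons, Function.update_self]
  congr 1
  refine Multiset.map_congr rfl fun l hl => ?_
  rw [Function.update_of_ne (Finset.ne_of_mem_erase hl)]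

theorem map_update_of_notMem [DecidableEq ι] {R : Finset ι} {i : ι} (hi : i ∉ R) (x : ι → B) (y θ : B) :
    (R.val.map fun l => Function.update x i y l - θ) = R.val.map fun l => x l - θ := by
  refine Multiset.map_congr rfl fun l hl => ?_
  rw [Function.update_of_ne (ne_of_mem_of_not_mem hl hi)]

theorem prod_map_enorm (R : Finset ι) (w : ι → B) (θ : B) :
    ((R.val.map fun i => w i - θ).map fun y => ‖y‖ₑ).prod = ∏ l ∈ R, ‖w l - θ‖ₑ := by
  rw [Multiset.map_map]
  rfl

end Sample

/-! ### Second moments for a fixed pilot value. -/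

section Conditional

variable {B : Type*} [NormedAddCommGroup B] [NormedSpace ℝ B] {f : B → ℝ} {s n : ℕ}

theorem exists_dual_taylorRem_cons {θ t : B} (hft : ContDiffAt ℝ s f t) (hfθ : ContDiffAt ℝ s f θ)
    {M : Multiset B} (hM : M.card < s) :
    ∃ u : StrongDual ℝ B, ∀ y, taylorRem f s θ t (y ::ₘ M) = u y := by
  obtain ⟨v, hv⟩ := exists_dual_multiDeriv_cons hfθ hM
  have h : ∀ i, ∃ u : StrongDual ℝ B, i ∈ Finset.range (s - (M.card + 1) + 1) →
      ∀ y, multiDeriv f t (y ::ₘ (M + Multiset.replicate i (θ - t))) = u y := by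
    intro i
    by_cases hi : i ∈ Finset.range (s - (M.card + 1) + 1)
    · have hi' := Finset.mem_range.1 hi
      obtain ⟨u, hu⟩ := exists_dual_multiDeriv_cons hft
        (M := M + Multiset.replicate i (θ - t)) (by simp; omega)
      exact ⟨u, fun _ => hu⟩
    -- A filler outside the summation range, so that functionals can be chosen for all i.
    · exact ⟨0, fun h => absurd h hi⟩
  choose u hu using h
  refine ⟨∑ i ∈ Finset.range (s - (M.card + 1) + 1), (i ! : ℝ)⁻¹ • u i - v, fun y => ?_⟩
  rw [taylorRem, hv, Multiset.card_cons]
  simp only [sub_apply, sum_apply, smul_apply, smul_eq_mul]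
  congr 1
  refine Finset.sum_congr rfl fun i hi => ?_
  rw [Multiset.cons_add, hu i hi y]

theorem continuous_taylorRem_map {θ t : B} (hft : ContDiffAt ℝ s f t) (hfθ : ContDiffAt ℝ s f θ)
    {R : Finset (Fin n)} (hR : R.card ≤ s) :
    Continuous fun w : Fin n → B => taylorRem f s θ t (R.val.map fun i => w i - θ) := by
  unfold taylorRem
  simp only [Multiset.card_map, Finset.card_val]
  refine Continuous.sub (continuous_finsetSum _ fun i hi => continuous_const.mul ?_) ?_
  · have hi' := Finset.mem_range.1 hi
    exact continuous_multiDeriv_map hft (a := fun (w : Fin n → B) i => w i - θ)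
      (fun i => by fun_prop) R _ (by simp; omega)
  · have := continuous_multiDeriv_map hfθ (a := fun (w : Fin n → B) i => w i - θ)
      (fun i => by fun_prop) R 0 (by simpa using hR)
    simpa using this

variable [CompleteSpace B] [TopologicalSpace.SeparableSpace B] [MeasurableSpace B] [BorelSpace B]
  (P : Measure B) [IsProbabilityMeasure P]

/-- Variance of the U-statistic of a derivative at the mean. -/
theorem lintegral_uStat_sq_le (hP : Integrable (fun w : B => w) P)
    (hf : ContDiffAt ℝ s f (mean P)) {k : ℕ} (hk1 : 1 ≤ k) (hks : k ≤ s) (hkn : k ≤ n) :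
    ∫⁻ w : Fin n → B, ‖((k ! : ℕ) : ℝ)⁻¹ * uStat w (mean P) (iteratedFDeriv ℝ k f (mean P))‖ₑ ^ 2
        ∂(Measure.pi fun _ => P) ≤
      ‖iteratedFDeriv ℝ k f (mean P)‖ₑ ^ 2 * (weakVar P / n * (strongVar P / n) ^ (k - 1)) := by
  have : SecondCountableTopology B := UniformSpace.secondCountable_of_separable B
  set θ := mean P with hθ
  set c : ℝ := ((k ! : ℝ) * n.choose k)⁻¹ with hc
  set 𝓡 := Finset.powersetCard k (Finset.univ : Finset (Fin n)) with h𝓡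
  let Y : Finset (Fin n) → (Fin n → B) → ℝ := fun R w =>
    c * multiDeriv f θ (R.val.map fun i => w i - θ)
  have hcard : ∀ R ∈ 𝓡, R.card = k := fun R hR => (Finset.mem_powersetCard.1 hR).2
  have h1 : ∀ w : Fin n → B, ((k ! : ℕ) : ℝ)⁻¹ * uStat w θ (iteratedFDeriv ℝ k f θ) =
      ∑ R ∈ 𝓡, Y R w := by
    intro w
    rw [uStat_eq_sum_powersetCard hf hks, ← mul_assoc, ← mul_inv, Finset.mul_sum]
  have hmeas : ∀ R ∈ 𝓡, Measurable (Y R) := by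
    intro R hR
    have := continuous_multiDeriv_map hf (a := fun (w : Fin n → B) i => w i - θ)
      (fun i => by fun_prop) R 0 (by simp [hcard R hR, hks])
    simp only [add_zero] at this
    exact (continuous_const.mul this).measurable
  have hlin : ∀ R ∈ 𝓡, ∀ i ∈ R, ∀ x, ∃ u : StrongDual ℝ B,
      ∀ y, Y R (Function.update x i y) = u (y - mean P) := by
    intro R hR i hi x
    have hR' := hcard R hR
    obtain ⟨u, hu⟩ := exists_dual_multiDeriv_cons hf
      (M := (R.erase i).val.map fun l => x l - θ)
      (by rw [Multiset.card_map, Finset.card_val, Finset.card_erase_of_mem hi]; omega)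
    refine ⟨c • u, fun y => ?_⟩
    simp only [Y, map_update_of_mem hi, hu, ← hθ]
    simp
  have hind : ∀ R ∈ 𝓡, ∀ i ∉ R, ∀ x y, Y R (Function.update x i y) = Y R x := by
    intro R _ i hi x y
    simp only [Y, map_update_of_notMem hi]
  simp_rw [h1]
  refine (lintegral_sq_sum_le P hP 𝓡 hmeas hlin hind).trans
    (le_trans (Finset.sum_le_sum fun R hR => ?_)
    (sum_powersetCard_variance_le hk1 hkn ‖iteratedFDeriv ℝ k f θ‖ₑ (weakVar P) (strongVar P)))
  have hR' := hcard R hR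
  obtain ⟨i, hi⟩ : R.Nonempty := Finset.card_pos.1 (by omega)
  rw [← hR']
  refine lintegral_sq_le_of_bound P hi (hmeas R hR) (hlin R hR i hi) fun x => ?_
  rw [hR', ← hc, enorm_mul, mul_assoc]
  gcongr
  refine (enorm_multiDeriv_le f θ (k := k) (by simp [hR'])).trans_eq ?_
  rw [prod_map_enorm]

/-- Second moment, for a fixed pilot value `t`, of the error of the one-sided estimator after
subtraction of the U-statistics of the derivatives at the mean. -/
theorem lintegral_oneSided_remainder_sq_le (hP : Integrable (fun w : B => w) P) {Θ : Set B}
    (hΘ : IsOpen Θ) (hmean : mean P ∈ Θ) {m ρ : ℝ} (hρ : 0 < ρ) (hm : m = s + ρ)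
    (hf : ContDiffOn ℝ s f Θ) (hsn : s ≤ n) {t : B} (ht : t ∈ Θ)
    (hseg : 1 ≤ s → segment ℝ (mean P) t ⊆ Θ) :
    ∫⁻ w : Fin n → B, ‖oneSided f s w t - (f (mean P) + ∑ k ∈ Finset.Icc 1 s,
        ((k ! : ℕ) : ℝ)⁻¹ * uStat w (mean P) (iteratedFDeriv ℝ k f (mean P)))‖ₑ ^ 2
        ∂(Measure.pi fun _ => P) ≤
      lipSeminorm ρ Θ (fun x => iteratedFDeriv ℝ s f x) ^ 2 * ‖t - mean P‖ₑ ^ (2 * m) +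
        if 1 ≤ s then ENNReal.ofReal (Real.exp 1) * weakVar P / n *
          (lipSeminorm ρ Θ (fun x => iteratedFDeriv ℝ s f x) ^ 2 *
            max (‖t - mean P‖ₑ ^ 2) (strongVar P / n) ^ (m - 1)) else 0 := by
  have : SecondCountableTopology B := UniformSpace.secondCountable_of_separable B
  set θ := mean P with hθ
  set L := lipSeminorm ρ Θ (fun x => iteratedFDeriv ℝ s f x) with hL
  have hft : ContDiffAt ℝ s f t := hf.contDiffAt (hΘ.mem_nhds ht)
  have hfθ : ContDiffAt ℝ s f θ := hf.contDiffAt (hΘ.mem_nhds hmean)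
  let c : ℕ → ℝ := fun k => ((k ! : ℝ) * n.choose k)⁻¹
  let K : ℕ → ℝ≥0∞ := fun k => ((s - k)! : ℝ≥0∞)⁻¹ * (L * ‖t - θ‖ₑ ^ (((s - k : ℕ) : ℝ) + ρ))
  let Y : Finset (Fin n) → (Fin n → B) → ℝ := fun R w =>
    c R.card * taylorRem f s θ t (R.val.map fun i => w i - θ)
  set 𝓡 := Finset.univ.filter fun R : Finset (Fin n) => R.card ≤ s with h𝓡
  have hcard : ∀ R ∈ 𝓡, R.card ≤ s := fun R hR => (Finset.mem_filter.1 hR).2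
  have hmeas : ∀ R ∈ 𝓡, Measurable (Y R) := fun R hR =>
    (continuous_const.mul (continuous_taylorRem_map hft hfθ (hcard R hR))).measurable
  have hlin : ∀ R ∈ 𝓡, ∀ i ∈ R, ∀ x, ∃ u : StrongDual ℝ B,
      ∀ y, Y R (Function.update x i y) = u (y - mean P) := by
    intro R hR i hi x
    have hR' := hcard R hR
    have hpos : 0 < R.card := Finset.card_pos.2 ⟨i, hi⟩
    obtain ⟨u, hu⟩ := exists_dual_taylorRem_cons hft hfθ
      (M := (R.erase i).val.map fun l => x l - θ)
      (by rw [Multiset.card_map, Finset.card_val, Finset.card_erase_of_mem hi]; omega)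
    refine ⟨c R.card • u, fun y => ?_⟩
    simp only [Y, map_update_of_mem hi, hu, ← hθ]
    simp
  have hind : ∀ R ∈ 𝓡, ∀ i ∉ R, ∀ x y, Y R (Function.update x i y) = Y R x := by
    intro R _ i hi x y
    simp only [Y, map_update_of_notMem hi]
  have hbound : ∀ R ∈ 𝓡, ∀ x, ‖Y R x‖ₑ ≤ (‖c R.card‖ₑ * K R.card) * ∏ l ∈ R, ‖x l - θ‖ₑ := by
    intro R hR x
    rw [enorm_mul, mul_assoc]
    gcongr
    have h := enorm_taylorRem_le hΘ hf hmean ht hseg hρ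
      (M := R.val.map fun i => x i - θ) (by simpa using hcard R hR)
    rw [prod_map_enorm] at h
    simpa [K] using h
  simp_rw [oneSided_sub_eq_sum_taylorRem hft hfθ hsn]
  refine (lintegral_sq_sum_le P hP 𝓡 hmeas hlin hind).trans ?_
  -- The empty set gives a deterministic remainder, the bias, with no factor ν; it is treated apart.
  let F : ℕ → Finset (Fin n) → ℝ≥0∞ := fun k _ => if k = 0 then K 0 ^ 2 else
    (‖c k‖ₑ * K k) ^ 2 * weakVar P * strongVar P ^ (k - 1)
  have hF : ∀ R ∈ 𝓡, ∫⁻ x, ‖Y R x‖ₑ ^ 2 ∂(Measure.pi fun _ : Fin n => P) ≤ F R.card R := by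
    intro R hR
    by_cases h0 : R.card = 0
    · obtain rfl := Finset.card_eq_zero.1 h0
      simp only [F, Finset.card_empty, if_true]
      calc _ ≤ ∫⁻ x : Fin n → B, K 0 ^ 2 ∂(Measure.pi fun _ : Fin n => P) := by
            refine lintegral_mono fun x => ?_
            have := hbound ∅ hR x
            simp only [Finset.card_empty, Finset.prod_empty, mul_one, c] at this
            simp only [Nat.factorial_zero, Nat.cast_one, Nat.choose_zero_right, mul_one, inv_one,
              enorm_one, one_mul] at this
            gcongr
        _ = _ := by simp
    · obtain ⟨i, hi⟩ : R.Nonempty := Finset.card_pos.1 (by omega)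
      simp only [F, if_neg h0]
      exact lintegral_sq_le_of_bound P hi (hmeas R hR) (hlin R hR i hi) (hbound R hR)
  refine (Finset.sum_le_sum hF).trans ?_
  rw [h𝓡, ← sum_range_powersetCard, Finset.sum_range_succ', add_comm]
  have hinv : ∀ k : ℕ, (k ! : ℝ≥0∞)⁻¹ ≤ 1 := fun k => by
    rw [ENNReal.inv_le_one]
    exact_mod_cast Nat.factorial_pos k
  refine add_le_add ?_ ?_
  · simp only [Finset.powersetCard_zero, Finset.sum_singleton, F, if_true, K, Nat.sub_zero, ← hm]
    calc _ ≤ (1 * (L * ‖t - θ‖ₑ ^ m)) ^ 2 := by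
          gcongr
          exact hinv s
      _ = _ := by
          rw [one_mul, mul_pow, ← ENNReal.rpow_mul_natCast, mul_comm m]
          norm_num
  · split_ifs with hs
    swap
    · obtain rfl : s = 0 := by omega
      simp
    set M := max (‖t - θ‖ₑ ^ 2) (strongVar P / n) with hM
    have hk : ∀ k ∈ Finset.range s,
        ∑ A ∈ Finset.powersetCard (k + 1) (Finset.univ : Finset (Fin n)), F (k + 1) A ≤
          ((s - (k + 1))! : ℝ≥0∞)⁻¹ * (weakVar P / n * (L ^ 2 * M ^ (m - 1))) := by
      intro k hk
      have hk' := Finset.mem_range.1 hk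
      simp only [F, if_neg (Nat.succ_ne_zero k)]
      refine (sum_powersetCard_variance_le (by omega) (by omega) _ _ _).trans ?_
      have he : (((s - (k + 1) : ℕ) : ℝ) + ρ) + k = m - 1 := by
        rw [Nat.cast_sub (by omega), hm]
        push_cast
        ring
      have hexp : 0 ≤ ((s - (k + 1) : ℕ) : ℝ) + ρ := by positivity
      calc K (k + 1) ^ 2 * (weakVar P / n * (strongVar P / n) ^ (k + 1 - 1))
          = ((s - (k + 1))! : ℝ≥0∞)⁻¹ * ((s - (k + 1))! : ℝ≥0∞)⁻¹ * (weakVar P / n * (L ^ 2 *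
            ((‖t - θ‖ₑ ^ 2) ^ (((s - (k + 1) : ℕ) : ℝ) + ρ) * (strongVar P / n) ^ k))) := by
            simp only [K, mul_pow, Nat.add_sub_cancel]
            rw [← ENNReal.rpow_mul_natCast, mul_comm (((s - (k + 1) : ℕ) : ℝ) + ρ),
              ENNReal.rpow_natCast_mul]
            ring
        -- One of the two inverse factorials is kept, for the sum giving e. Replacing both bases by
        -- their maximum makes the exponents add up to m - 1 for every k.
        _ ≤ ((s - (k + 1))! : ℝ≥0∞)⁻¹ * 1 * (weakVar P / n * (L ^ 2 *
            (M ^ (((s - (k + 1) : ℕ) : ℝ) + ρ) * M ^ k))) := by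
            gcongr
            · exact hinv _
            · exact le_max_left _ _
            · exact le_max_right _ _
        _ = _ := by
            rw [← ENNReal.rpow_natCast M k, ← ENNReal.rpow_add_of_nonneg _ _ hexp (by positivity), he,
              mul_one]
    refine (Finset.sum_le_sum hk).trans ?_
    rw [← Finset.sum_mul, mul_div_assoc, mul_assoc]
    gcongr
    exact sum_range_inv_factorial_le s

end Conditional

/-! ### Square roots and the L² norm with values in [0,∞]. -/

section RootMean

variable {Ω : Type*} [MeasurableSpace Ω] {μ : Measure Ω}

theorem sqrtE_mono {a b : ℝ≥0∞} (h : a ≤ b) : sqrtE a ≤ sqrtE b :=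
  ENNReal.rpow_le_rpow h (by norm_num)

theorem sqrtE_mul (a b : ℝ≥0∞) : sqrtE (a * b) = sqrtE a * sqrtE b :=
  ENNReal.mul_rpow_of_nonneg _ _ (by norm_num)

theorem sqrtE_sq (a : ℝ≥0∞) : sqrtE (a ^ 2) = a := by
  rw [sqrtE, ← ENNReal.rpow_natCast, ← ENNReal.rpow_mul]
  norm_num

theorem sqrtE_pow (a : ℝ≥0∞) (k : ℕ) : sqrtE (a ^ k) = sqrtE a ^ k := by
  rw [sqrtE, sqrtE, ← ENNReal.rpow_natCast, ← ENNReal.rpow_natCast, ← ENNReal.rpow_mul,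
    ← ENNReal.rpow_mul, mul_comm]

theorem sqrtE_add_le (a b : ℝ≥0∞) : sqrtE (a + b) ≤ sqrtE a + sqrtE b :=
  ENNReal.rpow_add_le_add_rpow _ _ (by norm_num) (by norm_num)

theorem rootMean_eq_sqrtE (X : Ω → ℝ≥0∞) : rootMean μ X = sqrtE (∫⁻ ω, X ω ∂μ) := rfl

theorem rootMean_add_le {g h : Ω → ℝ} (hg : AEMeasurable g μ) (hh : AEMeasurable h μ) :
    rootMean μ (fun ω => ‖g ω + h ω‖ₑ ^ 2) ≤
      rootMean μ (fun ω => ‖g ω‖ₑ ^ 2) + rootMean μ (fun ω => ‖h ω‖ₑ ^ 2) := by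
  have h1 := ENNReal.lintegral_Lp_add_le (μ := μ) (p := 2) hg.enorm hh.enorm (by norm_num)
  simp only [ENNReal.rpow_two] at h1
  refine le_trans (ENNReal.rpow_le_rpow (lintegral_mono fun ω => ?_) (by norm_num)) h1
  simp only [Pi.add_apply]
  gcongr
  exact enorm_add_le _ _

theorem rootMean_const_mul (c : ℝ) (g : Ω → ℝ) :
    rootMean μ (fun ω => ‖c * g ω‖ₑ ^ 2) = ‖c‖ₑ * rootMean μ (fun ω => ‖g ω‖ₑ ^ 2) := by
  simp only [rootMean_eq_sqrtE, enorm_mul, mul_pow]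
  rw [lintegral_const_mul' _ _ (by simp), sqrtE_mul, sqrtE_sq]

theorem rootMean_sum_le {κ : Type*} (S : Finset κ) {g : κ → Ω → ℝ}
    (hg : ∀ k ∈ S, AEMeasurable (g k) μ) :
    rootMean μ (fun ω => ‖∑ k ∈ S, g k ω‖ₑ ^ 2) ≤
      ∑ k ∈ S, rootMean μ (fun ω => ‖g k ω‖ₑ ^ 2) := by
  classical
  induction S using Finset.induction_on with
  | empty => simp [rootMean]
  | @insert k S hk ih =>
    simp only [Finset.sum_insert hk]
    refine (rootMean_add_le (hg k (by simp)) ?_).trans ?_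
    · exact Finset.aemeasurable_fun_sum _ fun j hj => hg j (by simp [hj])
    · gcongr
      exact ih fun j hj => hg j (by simp [hj])

end RootMean

/-! ### Continuity and openness facts behind measurability. -/

section Measurability

variable {B : Type*} [NormedAddCommGroup B] [NormedSpace ℝ B] {f : B → ℝ} {s n : ℕ} {Θ : Set B}

theorem continuousOn_oneSided (hΘ : IsOpen Θ) (hf : ContDiffOn ℝ s f Θ) :
    ContinuousOn (fun p : (Fin n → B) × B => oneSided f s p.1 p.2) (Set.univ ×ˢ Θ) := by
  have hsnd : Set.MapsTo (Prod.snd : (Fin n → B) × B → B) (Set.univ ×ˢ Θ) Θ := fun p hp => hp.2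
  unfold oneSided uStat
  refine ContinuousOn.add (hf.continuousOn.comp continuousOn_snd hsnd)
    (continuousOn_finsetSum _ fun k hk => continuousOn_const.mul (continuousOn_const.mul
      (continuousOn_finsetSum _ fun J _ => ?_)))
  have hk' : k ≤ s := (Finset.mem_Icc.1 hk).2
  have h1 : ContinuousOn (iteratedFDeriv ℝ k f) Θ :=
    (hf.continuousOn_iteratedFDerivWithin (by exact_mod_cast hk') hΘ.uniqueDiffOn).congr
      fun x hx => (iteratedFDerivWithin_of_isOpen k hΘ hx).symm
  exact ContinuousOn.eval (h1.comp continuousOn_snd hsnd)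
    (Continuous.continuousOn (by fun_prop))

theorem continuous_uStat {k : ℕ} (b : B) (T : ContinuousMultilinearMap ℝ (fun _ : Fin k => B) ℝ) :
    Continuous fun w : Fin n → B => uStat w b T := by
  unfold uStat
  exact continuous_const.mul (continuous_finsetSum _ fun J _ => T.cont.comp (by fun_prop))

/-- The unit interval is compact, so the condition persists near t. Openness makes the set
measurable, which transfers the segment hypothesis to the law of the pilot. -/
theorem isOpen_setOf_segment_subset (hΘ : IsOpen Θ) (θ : B) :
    IsOpen {t | segment ℝ θ t ⊆ Θ} := by
  have h : {t | segment ℝ θ t ⊆ Θ} = {t | ∀ r ∈ Set.Icc (0 : ℝ) 1, θ + r • (t - θ) ∈ Θ} := by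
    ext t
    rw [Set.mem_ofPred_eq, segment_eq_image', Set.image_subset_iff]
    rfl
  rw [h, isOpen_iff_eventually]
  intro t ht
  refine isCompact_Icc.eventually_forall_of_forall_eventually fun r hr => ?_
  have hc : Continuous fun z : B × ℝ => θ + z.2 • (z.1 - θ) := by fun_prop
  exact hc.continuousAt.eventually (hΘ.mem_nhds (ht r hr))

end Measurability

/-! ### The one-sided estimator with a random pilot. -/

section OneSided

variable {B : Type*} [NormedAddCommGroup B] [NormedSpace ℝ B] {f : B → ℝ} {s n : ℕ} {Θ : Set B}

/-- The degree `k` term of the expansion of the estimator at `θ`. -/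
def uTerm (f : B → ℝ) (θ : B) (k : ℕ) (w : Fin n → B) : ℝ :=
  ((k ! : ℕ) : ℝ)⁻¹ * uStat w θ (iteratedFDeriv ℝ k f θ)

/-- The one-sided estimator minus its expansion at `θ`. -/
def oneSidedRem (f : B → ℝ) (s : ℕ) (θ : B) (w : Fin n → B) (t : B) : ℝ :=
  oneSided f s w t - (f θ + ∑ k ∈ Finset.Icc 1 s, uTerm f θ k w)

theorem continuous_uTerm (f : B → ℝ) (θ : B) (k : ℕ) :
    Continuous fun w : Fin n → B => uTerm f θ k w :=
  continuous_const.mul (continuous_uStat _ _)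

theorem uTerm_one {θ : B} (hf : ContDiffAt ℝ 1 f θ) (w : Fin n → B) :
    uTerm f θ 1 w = (n : ℝ)⁻¹ * ∑ i, fderiv ℝ f θ (w i - θ) := by
  have h1 : ∀ v : B, multiDeriv f θ {v} = fderiv ℝ f θ v := by
    intro v
    have := multiDeriv_univ_map (s := 1) hf le_rfl (fun _ : Fin 1 => v)
    rw [iteratedFDeriv_one_apply] at this
    rw [← this]
    rfl
  rw [uTerm, uStat_eq_sum_powersetCard (s := 1) hf le_rfl, Finset.powersetCard_one]
  simp [h1]

variable [TopologicalSpace.SeparableSpace B] [MeasurableSpace B] [BorelSpace B] {P : Measure B}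
  {Ω Ω' : Type*} [MeasurableSpace Ω] {μ : Measure Ω} [MeasurableSpace Ω'] {μ' : Measure Ω'}
  {θn : Ω' → B} {Z : Ω → Fin n → B} {τ : Ω → B}

/-- Nothing is known about f off Θ, so only almost everywhere measurability is available: the
remainder is continuous where the pilot lies in Θ, a set of full measure. -/
theorem aemeasurable_oneSidedRem (hΘ : IsOpen Θ) (hf : ContDiffOn ℝ s f Θ) (θ : B)
    (hθn : AEMeasurable θn μ') (hθΘ : ∀ᵐ ω ∂μ', θn ω ∈ Θ) :
    AEMeasurable (fun p : (Fin n → B) × B => oneSidedRem f s θ p.1 p.2)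
      ((Measure.pi fun _ => P).prod (μ'.map θn)) := by
  have : SecondCountableTopology B := UniformSpace.secondCountable_of_separable B
  have hQ : ∀ᵐ t ∂(μ'.map θn), t ∈ Θ := (ae_map_iff hθn hΘ.measurableSet).2 hθΘ
  have hcont : ContinuousOn (fun p : (Fin n → B) × B => oneSidedRem f s θ p.1 p.2)
      (Set.univ ×ˢ Θ) := by
    unfold oneSidedRem
    exact (continuousOn_oneSided hΘ hf).sub (Continuous.continuousOn (continuous_const.add
      (continuous_finsetSum _ fun k _ => (continuous_uTerm f θ k).comp continuous_fst)))
  have hset : ∀ᵐ p ∂((Measure.pi fun _ : Fin n => P).prod (μ'.map θn)),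
      p ∈ (Set.univ : Set (Fin n → B)) ×ˢ Θ := by
    have := Measure.quasiMeasurePreserving_snd (μ := Measure.pi fun _ : Fin n => P)
      (ν := μ'.map θn) |>.ae hQ
    filter_upwards [this] with p hp using ⟨Set.mem_univ _, hp⟩
  have hmeas := hcont.aemeasurable (μ := (Measure.pi fun _ : Fin n => P).prod (μ'.map θn))
    (MeasurableSet.univ.prod hΘ.measurableSet)
  rwa [Measure.restrict_eq_self_of_ae_mem hset] at hmeas

variable [CompleteSpace B] [IsProbabilityMeasure P]

theorem rootMean_uTerm_le (hP : Integrable (fun w : B => w) P) (hf : ContDiffAt ℝ s f (mean P))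
    (hZ : AEMeasurable Z μ) (hlaw : μ.map Z = Measure.pi fun _ => P)
    {k : ℕ} (hk1 : 1 ≤ k) (hks : k ≤ s) (hkn : k ≤ n) :
    rootMean μ (fun ω => ‖uTerm f (mean P) k (Z ω)‖ₑ ^ 2) ≤
      sqrtE (weakVar P / n) *
        (‖iteratedFDeriv ℝ k f (mean P)‖ₑ * sqrtE (strongVar P / n) ^ (k - 1)) := by
  have : SecondCountableTopology B := UniformSpace.secondCountable_of_separable B
  have hm : Measurable fun w : Fin n → B => ‖uTerm f (mean P) k w‖ₑ ^ 2 :=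
    (continuous_uTerm f (mean P) k).measurable.enorm.pow_const 2
  rw [rootMean_eq_sqrtE, ← lintegral_map' (f := fun w => ‖uTerm f (mean P) k w‖ₑ ^ 2)
    hm.aemeasurable hZ, hlaw]
  refine (sqrtE_mono (lintegral_uStat_sq_le P hP hf hk1 hks hkn)).trans_eq ?_
  rw [sqrtE_mul, sqrtE_mul, sqrtE_sq, sqrtE_pow]
  ring

/-- Sample and pilot have a product law, so by Tonelli the bound for fixed t is integrated over the
law of the pilot; the square root is then subadditive. -/
theorem rootMean_oneSidedRem_le [IsFiniteMeasure μ'] (hP : Integrable (fun w : B => w) P) (hΘ : IsOpen Θ)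
    (hmean : mean P ∈ Θ) {m ρ : ℝ} (hρ : 0 < ρ) (hm : m = s + ρ) (hf : ContDiffOn ℝ s f Θ)
    (hsn : s ≤ n) (hθn : AEMeasurable θn μ') (hθΘ : ∀ᵐ ω ∂μ', θn ω ∈ Θ)
    (hseg : 1 ≤ s → ∀ᵐ ω ∂μ', segment ℝ (mean P) (θn ω) ⊆ Θ)
    (hZτ : AEMeasurable (fun ω => (Z ω, τ ω)) μ)
    (hlaw : μ.map (fun ω => (Z ω, τ ω)) = (Measure.pi fun _ => P).prod (μ'.map θn)) :
    rootMean μ (fun ω => ‖oneSidedRem f s (mean P) (Z ω) (τ ω)‖ₑ ^ 2) ≤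
      lipSeminorm ρ Θ (fun x => iteratedFDeriv ℝ s f x) *
          rootMean μ' (fun ω => ‖θn ω - mean P‖ₑ ^ (2 * m)) +
        if 1 ≤ s then sqrtE (ENNReal.ofReal (Real.exp 1) * weakVar P / n) *
          lipSeminorm ρ Θ (fun x => iteratedFDeriv ℝ s f x) *
            rootMean μ' (fun ω => max (‖θn ω - mean P‖ₑ ^ 2) (strongVar P / n) ^ (m - 1))
        else 0 := by
  have : SecondCountableTopology B := UniformSpace.secondCountable_of_separable B
  set θ := mean P with hθ
  set L := lipSeminorm ρ Θ (fun x => iteratedFDeriv ℝ s f x) with hL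
  have hG : AEMeasurable (fun p : (Fin n → B) × B => ‖oneSidedRem f s θ p.1 p.2‖ₑ ^ 2)
      ((Measure.pi fun _ => P).prod (μ'.map θn)) :=
    (aemeasurable_oneSidedRem hΘ hf θ hθn hθΘ).enorm.pow_const 2
  have hQ : ∀ᵐ t ∂(μ'.map θn), t ∈ Θ := (ae_map_iff hθn hΘ.measurableSet).2 hθΘ
  have hQseg : ∀ᵐ t ∂(μ'.map θn), 1 ≤ s → segment ℝ θ t ⊆ Θ := by
    by_cases hs : 1 ≤ s
    · have := (ae_map_iff hθn (isOpen_setOf_segment_subset hΘ θ).measurableSet).2 (hseg hs)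
      filter_upwards [this] with t ht _ using ht
    · exact Filter.Eventually.of_forall fun t h => absurd h hs
  have hb1 : Measurable fun t : B => ‖t - θ‖ₑ ^ (2 * m) := by fun_prop
  have hb2 : Measurable fun t : B => max (‖t - θ‖ₑ ^ 2) (strongVar P / n) ^ (m - 1) := by fun_prop
  set e := ENNReal.ofReal (Real.exp 1)
  have hmain : ∫⁻ ω, ‖oneSidedRem f s θ (Z ω) (τ ω)‖ₑ ^ 2 ∂μ ≤
      L ^ 2 * ∫⁻ ω, ‖θn ω - θ‖ₑ ^ (2 * m) ∂μ' + if 1 ≤ s then e * weakVar P / n * (L ^ 2 *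
        ∫⁻ ω, max (‖θn ω - θ‖ₑ ^ 2) (strongVar P / n) ^ (m - 1) ∂μ') else 0 := by
    rw [← lintegral_map' (f := fun p : (Fin n → B) × B => ‖oneSidedRem f s θ p.1 p.2‖ₑ ^ 2)
      (by rwa [hlaw]) hZτ, hlaw, lintegral_prod_symm _ hG]
    refine (lintegral_mono_ae (g := fun t => L ^ 2 * ‖t - θ‖ₑ ^ (2 * m) +
      if 1 ≤ s then e * weakVar P / n *
          (L ^ 2 * max (‖t - θ‖ₑ ^ 2) (strongVar P / n) ^ (m - 1)) else 0) ?_).trans_eq ?_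
    · filter_upwards [hQ, hQseg] with t ht hts
      exact lintegral_oneSided_remainder_sq_le P hP hΘ hmean hρ hm hf hsn ht hts
    · rw [lintegral_add_left (hb1.const_mul _), lintegral_const_mul _ hb1,
        lintegral_map' hb1.aemeasurable hθn]
      congr 1
      split_ifs
      · rw [lintegral_const_mul _ (hb2.const_mul _), lintegral_const_mul _ hb2,
          lintegral_map' hb2.aemeasurable hθn]
      · simp
  refine (sqrtE_mono hmain).trans ((sqrtE_add_le _ _).trans_eq ?_)
  rw [sqrtE_mul, sqrtE_sq, rootMean_eq_sqrtE, rootMean_eq_sqrtE]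
  congr 1
  split_ifs
  · rw [sqrtE_mul, sqrtE_mul, sqrtE_sq, mul_assoc]
  · simp [sqrtE]

end OneSided

/-! ### Independence of the two halves. -/

section Law

variable {B : Type*} [MeasurableSpace B] {P : Measure B} {Ω : Type*} [MeasurableSpace Ω]
  {μ : Measure Ω} [IsProbabilityMeasure μ] {ι : Type*} {n : ℕ}

/-- A subsample of an i.i.d. sample together with a statistic of a disjoint subsample. -/
theorem map_subsample_statistic {W : ι → Ω → B} (hW : ∀ i, Measurable (W i))
    (hlaw : ∀ i, μ.map (W i) = P) (hindep : iIndepFun W μ) {e e' : Fin n → ι}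
    (he : Function.Injective e) (hdisj : ∀ i j, e i ≠ e' j) {T : (Fin n → B) → B}
    (hT : Measurable T) :
    μ.map (fun ω => ((fun i => W (e i) ω), T fun i => W (e' i) ω)) =
      (Measure.pi fun _ : Fin n => P).prod (μ.map fun ω => T fun i => W (e' i) ω) := by
  classical
  have h1 : μ.map (fun ω i => W (e i) ω) = Measure.pi fun _ : Fin n => P := by
    have := (hindep.precomp he).map_fun_eq_pi_map (fun i => (hW (e i)).aemeasurable)
    simpa [hlaw] using this
  have h2 := hindep.indepFun_finset (Finset.univ.image e) (Finset.univ.image e')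
    (by
      rw [Finset.disjoint_left]
      simp only [Finset.mem_image, Finset.mem_univ, true_and]
      rintro _ ⟨i, rfl⟩ ⟨j, hj⟩
      exact hdisj i j hj.symm) hW
  have hm : Measurable fun (v : ↥(Finset.univ.image e) → B) (i : Fin n) =>
      v ⟨e i, by simp⟩ := by fun_prop
  have hm' : Measurable fun (v : ↥(Finset.univ.image e') → B) =>
      T fun i => v ⟨e' i, by simp⟩ := hT.comp (by fun_prop)
  have h3 : IndepFun (fun ω i => W (e i) ω) (fun ω => T fun i => W (e' i) ω) μ :=
    h2.comp hm hm'
  have hTm : Measurable fun ω => T fun i => W (e' i) ω := hT.comp (by fun_prop)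
  rw [h3.map_prod_eq_prod_map_map (by fun_prop) hTm.aemeasurable, h1]

end Law

/-! ### Assembling the bound for one half and averaging the two. -/

section Total

variable {B : Type*} [NormedAddCommGroup B] [NormedSpace ℝ B]
  [TopologicalSpace.SeparableSpace B] [MeasurableSpace B] [BorelSpace B] [CompleteSpace B]
  {P : Measure B} [IsProbabilityMeasure P] {f : B → ℝ} {s n : ℕ} {Θ : Set B}
  {Ω Ω' : Type*} [MeasurableSpace Ω] {μ : Measure Ω} [MeasurableSpace Ω'] {μ' : Measure Ω'}
  {θn : Ω' → B}

/-- The error bound for a sample of size `n`: `S` is the set of degrees of the U-statistics at the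
mean that contribute. -/
def errorBound (P : Measure B) (f : B → ℝ) (s n : ℕ) (Θ : Set B) (m ρ : ℝ) (μ' : Measure Ω')
    (θn : Ω' → B) (S : Finset ℕ) : ℝ≥0∞ :=
  lipSeminorm ρ Θ (fun x => iteratedFDeriv ℝ s f x) *
      rootMean μ' (fun ω => ‖θn ω - mean P‖ₑ ^ (2 * m)) +
    sqrtE (weakVar P / n) *
      ∑ k ∈ S, ‖iteratedFDeriv ℝ k f (mean P)‖ₑ * sqrtE (strongVar P / n) ^ (k - 1) +
    if 1 ≤ s then sqrtE (ENNReal.ofReal (Real.exp 1) * weakVar P / n) *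
      lipSeminorm ρ Θ (fun x => iteratedFDeriv ℝ s f x) *
        rootMean μ' (fun ω => max (‖θn ω - mean P‖ₑ ^ 2) (strongVar P / n) ^ (m - 1))
    else 0

theorem rootMean_oneSided_le [IsFiniteMeasure μ'] (hP : Integrable (fun w : B => w) P)
    (hΘ : IsOpen Θ) (hmean : mean P ∈ Θ) {m ρ : ℝ} (hρ : 0 < ρ) (hm : m = s + ρ)
    (hf : ContDiffOn ℝ s f Θ) (hsn : s ≤ n) (hθn : AEMeasurable θn μ') (hθΘ : ∀ᵐ ω ∂μ', θn ω ∈ Θ)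
    (hseg : 1 ≤ s → ∀ᵐ ω ∂μ', segment ℝ (mean P) (θn ω) ⊆ Θ)
    {Z : Ω → Fin n → B} {τ : Ω → B} (hZ : Measurable Z) (hτ : Measurable τ)
    (hlawZ : μ.map Z = Measure.pi fun _ => P)
    (hlaw : μ.map (fun ω => (Z ω, τ ω)) = (Measure.pi fun _ => P).prod (μ'.map θn))
    {S : Finset ℕ} (hS : S ⊆ Finset.Icc 1 s) :
    AEMeasurable (fun ω => oneSidedRem f s (mean P) (Z ω) (τ ω) +
        ∑ k ∈ S, uTerm f (mean P) k (Z ω)) μ ∧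
      rootMean μ (fun ω => ‖oneSidedRem f s (mean P) (Z ω) (τ ω) +
        ∑ k ∈ S, uTerm f (mean P) k (Z ω)‖ₑ ^ 2) ≤ errorBound P f s n Θ m ρ μ' θn S := by
  have : SecondCountableTopology B := UniformSpace.secondCountable_of_separable B
  have hm1 : AEMeasurable (fun ω => oneSidedRem f s (mean P) (Z ω) (τ ω)) μ := by
    have h := aemeasurable_oneSidedRem (n := n) (P := P) hΘ hf (mean P) hθn hθΘ
    rw [← hlaw] at h
    exact h.comp_aemeasurable (hZ.prodMk hτ).aemeasurable
  have hm2 : ∀ k, Measurable fun ω => uTerm f (mean P) k (Z ω) := fun k =>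
    (continuous_uTerm f (mean P) k).measurable.comp hZ
  have hm3 : AEMeasurable (fun ω => ∑ k ∈ S, uTerm f (mean P) k (Z ω)) μ :=
    Finset.aemeasurable_fun_sum _ fun k _ => (hm2 k).aemeasurable
  refine ⟨hm1.add hm3, (rootMean_add_le hm1 hm3).trans ?_⟩
  have h1 := rootMean_oneSidedRem_le hP hΘ hmean hρ hm hf hsn hθn hθΘ hseg
    (hZ.prodMk hτ).aemeasurable hlaw
  have h2 : rootMean μ (fun ω => ‖∑ k ∈ S, uTerm f (mean P) k (Z ω)‖ₑ ^ 2) ≤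
      sqrtE (weakVar P / n) *
        ∑ k ∈ S, ‖iteratedFDeriv ℝ k f (mean P)‖ₑ * sqrtE (strongVar P / n) ^ (k - 1) := by
    refine (rootMean_sum_le S fun k _ => (hm2 k).aemeasurable).trans ?_
    rw [Finset.mul_sum]
    refine Finset.sum_le_sum fun k hk => ?_
    obtain ⟨hk1, hk2⟩ := Finset.mem_Icc.1 (hS hk)
    exact rootMean_uTerm_le hP (hf.contDiffAt (hΘ.mem_nhds hmean)) hZ.aemeasurable hlawZ hk1 hk2
      (hk2.trans hsn)
  refine (add_le_add h1 h2).trans_eq ?_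
  rw [errorBound, add_right_comm]

theorem rootMean_average_le {g₁ g₂ : Ω → ℝ} {b : ℝ≥0∞} (h₁ : AEMeasurable g₁ μ)
    (h₂ : AEMeasurable g₂ μ) (hb₁ : rootMean μ (fun ω => ‖g₁ ω‖ₑ ^ 2) ≤ b)
    (hb₂ : rootMean μ (fun ω => ‖g₂ ω‖ₑ ^ 2) ≤ b) :
    rootMean μ (fun ω => ‖(1 / 2 : ℝ) * (g₁ ω + g₂ ω)‖ₑ ^ 2) ≤ b := by
  rw [rootMean_const_mul]
  calc _ ≤ ‖(1 / 2 : ℝ)‖ₑ * (b + b) := by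
        gcongr
        exact (rootMean_add_le h₁ h₂).trans (add_le_add hb₁ hb₂)
    _ = b := by
        rw [← two_mul, ← mul_assoc, Real.enorm_eq_ofReal (by norm_num),
          ENNReal.ofReal_div_of_pos (by norm_num)]
        simp only [ENNReal.ofReal_one, ENNReal.ofReal_ofNat]
        rw [ENNReal.div_mul_cancel (by simp) (by simp), one_mul]

end Total

end CrossFit

end

/-! ### The theorem. -/

theorem mainTheorem3
    {B : Type*} [NormedAddCommGroup B] [NormedSpace ℝ B] [CompleteSpace B]
    [TopologicalSpace.SeparableSpace B] [MeasurableSpace B] [BorelSpace B]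
    -- the distribution and its mean, which lies in the open set `Θ`
    (P : Measure B) [IsProbabilityMeasure P] (hP : Integrable (fun w : B => w) P)
    (Θ : Set B) (hΘ : IsOpen Θ) (hmean : CrossFit.mean P ∈ Θ)
    -- smoothness `m = s + ρ`, `s = ⌈m⌉ - 1`, `ρ ∈ (0, 1]`
    (m ρ : ℝ) (s : ℕ) (hρ₀ : 0 < ρ) (hρ₁ : ρ ≤ 1) (hm : m = s + ρ)
    (f : B → ℝ) (hf : ContDiffOn ℝ s f Θ)
    -- the sample `W₁, …, W_{2n}`, i.i.d. from `P`
    (n : ℕ) (hn : 1 ≤ n) (hsn : s ≤ n)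
    {Ω : Type*} [MeasurableSpace Ω] (μ : Measure Ω) [IsProbabilityMeasure μ]
    (W : Fin (n + n) → Ω → B) (hW : ∀ i, Measurable (W i))
    (hlaw : ∀ i, μ.map (W i) = P) (hindep : iIndepFun W μ)
    -- the pilot estimators of the two halves, with the common law of `θn`
    (T₁ T₂ : (Fin n → B) → B) (hT₁ : Measurable T₁) (hT₂ : Measurable T₂)
    {Ω' : Type*} [MeasurableSpace Ω'] (μ' : Measure Ω') (θn : Ω' → B)
    (hθ₁ : IdentDistrib (fun ω => T₁ (CrossFit.half₁ fun i => W i ω)) θn μ μ')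
    (hθ₂ : IdentDistrib (fun ω => T₂ (CrossFit.half₂ fun i => W i ω)) θn μ μ')
    (hθΘ : ∀ᵐ ω ∂μ', θn ω ∈ Θ)
    (hseg : 1 ≤ s → ∀ᵐ ω ∂μ', segment ℝ (CrossFit.mean P) (θn ω) ⊆ Θ) :
    let θ : B := CrossFit.mean P
    let ν : ℝ≥0∞ := CrossFit.weakVar P
    let V : ℝ≥0∞ := CrossFit.strongVar P
    let e : ℝ≥0∞ := ENNReal.ofReal (Real.exp 1)
    let L : ℝ≥0∞ := CrossFit.lipSeminorm ρ Θ (fun x => iteratedFDeriv ℝ s f x)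
    let fhat : Ω → ℝ := fun ω => CrossFit.crossFit f s T₁ T₂ (fun i => W i ω)
    CrossFit.rootMean μ (fun ω => ‖fhat ω - f θ‖ₑ ^ 2)
        ≤ CrossFit.sqrtE 2 * L * CrossFit.rootMean μ' (fun ω => ‖θn ω - θ‖ₑ ^ (2 * m))
          + CrossFit.sqrtE (2 * ν / n)
            * ∑ k ∈ Finset.Icc 1 s, ‖iteratedFDeriv ℝ k f θ‖ₑ * CrossFit.sqrtE (V / n) ^ (k - 1)
          + (if 1 ≤ s then
              CrossFit.sqrtE (2 * e * ν / n) * L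
                * CrossFit.rootMean μ' (fun ω => max (‖θn ω - θ‖ₑ ^ 2) (V / n) ^ (m - 1))
            else 0)
    ∧ (1 ≤ s →
      CrossFit.rootMean μ (fun ω => ENNReal.ofReal
          (((n + n : ℕ) : ℝ) *
            (fhat ω - f θ - fderiv ℝ f θ (CrossFit.sampleMean (fun i => W i ω) - θ)) ^ 2))
        ≤ CrossFit.sqrtE (4 * n) * L * CrossFit.rootMean μ' (fun ω => ‖θn ω - θ‖ₑ ^ (2 * m))
          + CrossFit.sqrtE (4 * ν)
            * ∑ k ∈ Finset.Icc 2 s, ‖iteratedFDeriv ℝ k f θ‖ₑ * CrossFit.sqrtE (V / n) ^ (k - 1)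
          + CrossFit.sqrtE (4 * e * ν) * L
            * CrossFit.rootMean μ' (fun ω => max (‖θn ω - θ‖ₑ ^ 2) (V / n) ^ (m - 1))) := by
  intro θ ν V e L fhat
  -- Equality of laws forces equality of total masses.
  have hprob : IsProbabilityMeasure μ' := by
    constructor
    have h1 := congrArg (fun Q : Measure B => Q Set.univ) hθ₁.map_eq
    simp only [Measure.map_apply_of_aemeasurable hθ₁.aemeasurable_fst MeasurableSet.univ,
      Measure.map_apply_of_aemeasurable hθ₁.aemeasurable_snd MeasurableSet.univ,
      Set.preimage_univ, measure_univ] at h1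
    exact h1.symm
  let Z₁ : Ω → Fin n → B := fun ω => CrossFit.half₁ fun i => W i ω
  let Z₂ : Ω → Fin n → B := fun ω => CrossFit.half₂ fun i => W i ω
  have hZ₁ : Measurable Z₁ := measurable_pi_lambda _ fun i => hW _
  have hZ₂ : Measurable Z₂ := measurable_pi_lambda _ fun i => hW _
  have hcast : Function.Injective (Fin.castAdd n : Fin n → Fin (n + n)) :=
    Fin.castAdd_injective n n
  have hnat : Function.Injective (Fin.natAdd n : Fin n → Fin (n + n)) := Fin.natAdd_injective n n
  have hdisj : ∀ i j : Fin n, Fin.castAdd n i ≠ Fin.natAdd n j := by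
    intro i j h
    have := congrArg Fin.val h
    simp only [Fin.val_castAdd, Fin.val_natAdd] at this
    omega
  have hj₁ : μ.map (fun ω => (Z₁ ω, T₂ (Z₂ ω))) =
      (Measure.pi fun _ => P).prod (μ'.map θn) := by
    rw [← hθ₂.map_eq]
    exact CrossFit.map_subsample_statistic hW hlaw hindep hcast hdisj hT₂
  have hj₂ : μ.map (fun ω => (Z₂ ω, T₁ (Z₁ ω))) =
      (Measure.pi fun _ => P).prod (μ'.map θn) := by
    rw [← hθ₁.map_eq]
    exact CrossFit.map_subsample_statistic hW hlaw hindep hnat (fun i j => (hdisj j i).symm) hT₁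
  have hl₁ : μ.map Z₁ = Measure.pi fun _ => P := by
    have := (hindep.precomp hcast).map_fun_eq_pi_map (fun i => (hW _).aemeasurable)
    simp only [hlaw] at this
    exact this
  have hl₂ : μ.map Z₂ = Measure.pi fun _ => P := by
    have := (hindep.precomp hnat).map_fun_eq_pi_map (fun i => (hW _).aemeasurable)
    simp only [hlaw] at this
    exact this
  -- Kept general in S: all degrees 1, …, s give the first inequality, degrees 2, …, s the second.
  have hboth : ∀ S ⊆ Finset.Icc 1 s, CrossFit.rootMean μ (fun ω => ‖(1 / 2 : ℝ) *
      ((CrossFit.oneSidedRem f s θ (Z₁ ω) (T₂ (Z₂ ω)) + ∑ k ∈ S, CrossFit.uTerm f θ k (Z₁ ω)) +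
        (CrossFit.oneSidedRem f s θ (Z₂ ω) (T₁ (Z₁ ω)) +
          ∑ k ∈ S, CrossFit.uTerm f θ k (Z₂ ω)))‖ₑ ^ 2) ≤
      CrossFit.errorBound P f s n Θ m ρ μ' θn S := by
    intro S hS
    obtain ⟨h₁, hb₁⟩ := CrossFit.rootMean_oneSided_le hP hΘ hmean hρ₀ hm hf hsn
      hθ₁.aemeasurable_snd hθΘ hseg hZ₁ (hT₂.comp hZ₂) hl₁ hj₁ hS
    obtain ⟨h₂, hb₂⟩ := CrossFit.rootMean_oneSided_le hP hΘ hmean hρ₀ hm hf hsn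
      hθ₁.aemeasurable_snd hθΘ hseg hZ₂ (hT₁.comp hZ₁) hl₂ hj₂ hS
    exact CrossFit.rootMean_average_le h₁ h₂ hb₁ hb₂
  have hn0 : (n : ℝ≥0∞) ≠ 0 := by
    simp only [ne_eq, Nat.cast_eq_zero]
    omega
  have hntop : (n : ℝ≥0∞) ≠ ∞ := ENNReal.natCast_ne_top n
  have h24 : (2 : ℝ≥0∞) ≤ 4 := by norm_num
  refine ⟨?_, fun hs => ?_⟩
  · have hrw : ∀ ω, fhat ω - f θ = (1 / 2 : ℝ) *
        ((CrossFit.oneSidedRem f s θ (Z₁ ω) (T₂ (Z₂ ω)) +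
            ∑ k ∈ Finset.Icc 1 s, CrossFit.uTerm f θ k (Z₁ ω)) +
          (CrossFit.oneSidedRem f s θ (Z₂ ω) (T₁ (Z₁ ω)) +
            ∑ k ∈ Finset.Icc 1 s, CrossFit.uTerm f θ k (Z₂ ω))) := by
      intro ω
      simp only [fhat, CrossFit.crossFit, CrossFit.oneSidedRem, Z₁, Z₂]
      ring
    simp_rw [hrw]
    refine (hboth _ subset_rfl).trans ?_
    rw [CrossFit.errorBound]
    -- Slack: the bound just obtained lacks the factor √2 in each term.
    have h12 : (1 : ℝ≥0∞) ≤ 2 := by norm_num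
    refine add_le_add (add_le_add ?_ ?_) ?_
    · gcongr
      refine le_mul_of_one_le_left' ?_
      exact ENNReal.one_le_rpow h12 (by norm_num)
    · gcongr
      refine CrossFit.sqrtE_mono ?_
      gcongr
      exact le_mul_of_one_le_left' h12
    · split_ifs
      · gcongr
        refine CrossFit.sqrtE_mono ?_
        rw [mul_assoc 2]
        exact ENNReal.div_le_div_right (le_mul_of_one_le_left' h12) _
      · exact le_rfl
  · have hfθ : ContDiffAt ℝ 1 f θ :=
      (hf.contDiffAt (hΘ.mem_nhds hmean)).of_le (by exact_mod_cast hs)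
    have hlinear : ∀ ω, fderiv ℝ f θ (CrossFit.sampleMean (fun i => W i ω) - θ) =
        (1 / 2 : ℝ) * (CrossFit.uTerm f θ 1 (Z₁ ω) + CrossFit.uTerm f θ 1 (Z₂ ω)) := by
      intro ω
      have hnR : (n : ℝ) ≠ 0 := by
        simp only [ne_eq, Nat.cast_eq_zero]
        omega
      rw [CrossFit.uTerm_one hfθ, CrossFit.uTerm_one hfθ, CrossFit.sampleMean, Fin.sum_univ_add]
      simp only [map_sub, map_smul, map_add, map_sum, smul_eq_mul, Finset.sum_sub_distrib,
        Finset.sum_const, Finset.card_univ, Fintype.card_fin, nsmul_eq_mul, Z₁, Z₂,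
        CrossFit.half₁, CrossFit.half₂]
      push_cast
      field_simp
      ring
    have hrw : ∀ ω, fhat ω - f θ - fderiv ℝ f θ (CrossFit.sampleMean (fun i => W i ω) - θ) =
        (1 / 2 : ℝ) * ((CrossFit.oneSidedRem f s θ (Z₁ ω) (T₂ (Z₂ ω)) +
            ∑ k ∈ Finset.Icc 2 s, CrossFit.uTerm f θ k (Z₁ ω)) +
          (CrossFit.oneSidedRem f s θ (Z₂ ω) (T₁ (Z₁ ω)) +
            ∑ k ∈ Finset.Icc 2 s, CrossFit.uTerm f θ k (Z₂ ω))) := by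
      intro ω
      have hsplit : ∀ g : ℕ → ℝ, ∑ k ∈ Finset.Icc 1 s, g k = g 1 + ∑ k ∈ Finset.Icc 2 s, g k :=
        fun g => (Finset.add_sum_Ioc_eq_sum_Icc (f := g) hs).symm
      rw [hlinear]
      simp only [fhat, CrossFit.crossFit, CrossFit.oneSidedRem, Z₁, Z₂, hsplit]
      ring
    have hscale : ∀ x : ℝ, ENNReal.ofReal (((n + n : ℕ) : ℝ) * x ^ 2) =
        (2 * n : ℝ≥0∞) * ‖x‖ₑ ^ 2 := by
      intro x
      rw [ENNReal.ofReal_mul (by positivity), ENNReal.ofReal_natCast, ← sq_abs,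
        ENNReal.ofReal_pow (abs_nonneg _), ← Real.norm_eq_abs, ofReal_norm]
      push_cast
      ring
    simp_rw [hrw, hscale]
    rw [CrossFit.rootMean_eq_sqrtE, lintegral_const_mul' _ _ (by finiteness), CrossFit.sqrtE_mul,
      ← CrossFit.rootMean_eq_sqrtE]
    refine (mul_le_mul_right (hboth (Finset.Icc 2 s) (Finset.Icc_subset_Icc_left (by norm_num)))
      _).trans ?_
    -- The scaling N = 2n cancels the 1/n and leaves 2a, so the stated 4a again has a factor 2 to
    -- spare.
    have hcancel : ∀ a : ℝ≥0∞, CrossFit.sqrtE (2 * n) * CrossFit.sqrtE (a / n) ≤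
        CrossFit.sqrtE (4 * a) := by
      intro a
      rw [← CrossFit.sqrtE_mul]
      refine CrossFit.sqrtE_mono ?_
      rw [mul_assoc, ENNReal.mul_div_cancel hn0 hntop]
      gcongr
    rw [CrossFit.errorBound, if_pos hs, mul_add, mul_add]
    refine add_le_add (add_le_add ?_ ?_) ?_
    · rw [← mul_assoc]
      gcongr
      exact CrossFit.sqrtE_mono (by gcongr)
    · rw [← mul_assoc]
      gcongr
      exact hcancel ν
    · rw [← mul_assoc, ← mul_assoc, mul_assoc 4]
      gcongr
      exact hcancel _
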